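/- Let $\mu>0$ be a real number and, for $n,m\in\mathbb{N}$, let $$D_{n,m}=\{(z,\zeta)\in\mathbb{C}^n\times\mathbb{C}^m : \|\zeta\|^2<e^{-\mu\|z\|^2}\},$$ where $\|\cdot\|$ is the Euclidean norm. Let $K_{D_{n,m}}$ be the Bergman kernel of $D_{n,m}$, i.e. the reproducing kernel of the Hilbert space $L^2_a(D_{n,m})$ of holomorphic functions on $D_{n,m}$ that are square integrable with respect to Lebesgue measure: for every $p\in D_{n,m}$ the function $q\mapsto\overline{K_{D_{n,m}}(p,q)}$ lies in $L^2_a(D_{n,m})$, and $f(p)=\int_{D_{n,m}}f(q)\,K_{D_{n,m}}(p,q)\,dq$ for all $f\in L^2_a(D_{n,m})$. 1. If $n=1$ and $m\ge 1$, then $K_{D_{n,m}}$ is zero-free: $K_{D_{n,m}}(p,q)\ne 0$ for all $p,q\in D_{n,m}$. 2. If $m=1$ and $n\ge 2$, then $K_{D_{n,m}}$ has a zero: there are $p,q\in D_{n,m}$ with $K_{D_{n,m}}(p,q)=0$. -/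

import Mathlib

open MeasureTheory

/-- `f` belongs to the Bergman space `L²_a(Ω)` of an open set `Ω`: it is holomorphic on `Ω` and
square integrable on `Ω`. -/
def MemBergman {E : Type*} [NormedAddCommGroup E] [NormedSpace ℂ E] [MeasureSpace E]
    (Ω : Set E) (f : E → ℂ) : Prop :=
  DifferentiableOn ℂ f Ω ∧ MemLp f 2 (volume.restrict Ω)

/-- `K` is a reproducing kernel of `L²_a(Ω)`: for each `z ∈ Ω`, writing `K(z,w) = conj (K_z(w))`,
the function `K_z` lies in `L²_a(Ω)`, and `f(z) = ⟨f, K_z⟩ = ∫_Ω f(w) K(z,w) dw` for all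
`f ∈ L²_a(Ω)`. -/
def IsBergmanKernel {E : Type*} [NormedAddCommGroup E] [NormedSpace ℂ E] [MeasureSpace E]
    (Ω : Set E) (K : E → E → ℂ) : Prop :=
  ∀ z ∈ Ω, MemBergman Ω (fun w => starRingEnd ℂ (K z w)) ∧
    ∀ f : E → ℂ, MemBergman Ω f → f z = ∫ w in Ω, f w * K z w

/-- On an open set, the reproducing kernel of the Bergman space is unique. -/
theorem IsBergmanKernel.unique {E : Type*} [NormedAddCommGroup E] [NormedSpace ℂ E]
    [MeasureSpace E] [BorelSpace E] [(volume : Measure E).IsOpenPosMeasure]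
    {Ω : Set E} (hΩ : IsOpen Ω) {K K' : E → E → ℂ}
    (hK : IsBergmanKernel Ω K) (hK' : IsBergmanKernel Ω K') {z w : E} (hz : z ∈ Ω) (hw : w ∈ Ω) :
    K z w = K' z w := by
  obtain ⟨⟨hd, hl⟩, hr⟩ := hK z hz
  obtain ⟨⟨hd', hl'⟩, hr'⟩ := hK' z hz
  set g : E → ℂ := fun w => starRingEnd ℂ (K z w) - starRingEnd ℂ (K' z w) with hg
  have hgd : DifferentiableOn ℂ g Ω := hd.sub hd'
  have hgl : MemLp g 2 (volume.restrict Ω) := hl.sub hl'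
  have h1 := hr g ⟨hgd, hgl⟩
  have h2 := hr' g ⟨hgd, hgl⟩
  have hs : MemLp (fun w => K z w) 2 (volume.restrict Ω) := by
    simpa [Pi.star_def] using hl.star
  have hs' : MemLp (fun w => K' z w) 2 (volume.restrict Ω) := by
    simpa [Pi.star_def] using hl'.star
  have i1 : Integrable (fun w => g w * K z w) (volume.restrict Ω) := hgl.integrable_mul hs
  have i2 : Integrable (fun w => g w * K' z w) (volume.restrict Ω) := hgl.integrable_mul hs'
  have h3 : ∫ w in Ω, (g w * K z w - g w * K' z w) = 0 := by
    rw [integral_sub i1 i2, ← h1, ← h2, sub_self]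
  have h4 : ∀ w, g w * K z w - g w * K' z w = ((‖g w‖ ^ 2 : ℝ) : ℂ) := by
    intro w
    have : K z w - K' z w = starRingEnd ℂ (g w) := by simp [hg]
    rw [← mul_sub, this, Complex.mul_conj, Complex.normSq_eq_norm_sq]
  simp_rw [h4] at h3
  have h5 : ∫ w in Ω, ‖g w‖ ^ 2 = 0 := by
    have := integral_ofReal (𝕜 := ℂ) (μ := volume.restrict Ω) (f := fun w => ‖g w‖ ^ 2)
    exact Complex.ofReal_eq_zero.mp (this.symm.trans h3)
  have h50 : Integrable (fun w => ‖g w‖ ^ 2) (volume.restrict Ω) :=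
    hgl.integrable_norm_pow (by norm_num)
  rw [integral_eq_zero_iff_of_nonneg (fun _ => by positivity) h50] at h5
  have h6 : g =ᵐ[volume.restrict Ω] fun _ => 0 := by
    filter_upwards [h5] with x hx
    simpa using hx
  have h7 := Measure.eqOn_open_of_ae_eq h6 hΩ hgd.continuousOn continuousOn_const hw
  have h8 : starRingEnd ℂ (K z w) = starRingEnd ℂ (K' z w) := sub_eq_zero.mp h7
  exact (starRingEnd ℂ).injective h8

open scoped Classical in
/-- The Bergman kernel of an open set `Ω`: the reproducing kernel of `L²_a(Ω)`. (Its values matter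
on `Ω × Ω` only; were there no reproducing kernel, the value would be the junk value `0`.) -/
noncomputable def bergmanKernel {E : Type*} [NormedAddCommGroup E] [NormedSpace ℂ E]
    [MeasureSpace E] (Ω : Set E) : E → E → ℂ :=
  if h : ∃ K : E → E → ℂ, IsBergmanKernel Ω K then h.choose else 0

/-- The Hartogs domain `D_{n,m} = {(z, ζ) ∈ ℂⁿ × ℂᵐ : ‖ζ‖² < exp (-μ ‖z‖²)}`, with Euclidean norms.
The measure on `ℂⁿ × ℂᵐ` is the Lebesgue measure. -/
def hartogsFock (μ : ℝ) (n m : ℕ) : Set ((Fin n → ℂ) × (Fin m → ℂ)) :=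
  {p | ∑ j, ‖p.2 j‖ ^ 2 < Real.exp (-μ * ∑ i, ‖p.1 i‖ ^ 2)}

/-! The problem reduces to the zeros of `F(t) = ∑ fockCoeff n m k * t^k` in the unit disc. The
domain is invariant under the torus, so pairing `f` with `ζᵢ^k` recovers only the `k`-th Taylor
coefficient of the slice `w ↦ f (0, w eᵢ)`. Summing these against the reciprocal squared norms of
`ζᵢ^k` represents evaluation at `(0, s eᵢ)` by a constant times `F (s * conj qᵢ)`
(`isReproducingAt_single`).

The automorphisms that translate the base, together with the unitary maps of the fibre, move the
points `(0, s eᵢ)` onto the whole domain. Kernels change under them only by nonvanishing Jacobian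
factors (`IsReproducingAt.transport`), so if `F` has no zero in the disc, the kernel has no zero
either.

For `n = 1`, `F(t) = m! (m + t) / (1 - t)^(m + 2)`, whose only zero `-m` lies outside the open disc.
For `m = 1`, `t F(t) = ∑ k^(n+1) t^k`. The sum `∑ k^N t^k` has a zero in `(-1, 0)` for `N = 3` by an
explicit formula, and for larger `N` by Rolle's theorem, since it also vanishes at `0`. A zero of
`F` in `(-1, 0)` gives a zero of the kernel at two points of the `ζ`-axis. -/

/-- The numbers `(k+m)^n (k+m)!/k!`: up to a constant factor, the reciprocals of the squared norms of
`ζᵢ^k` in the Bergman space of `hartogsFock μ n m`. -/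
noncomputable def fockCoeff (n m k : ℕ) : ℝ := ((k : ℝ) + m) ^ n * ((k + m).factorial / k.factorial)

theorem fockCoeff_pos {m : ℕ} (hm : 1 ≤ m) (n k : ℕ) : 0 < fockCoeff n m k := by
  unfold fockCoeff
  have : (0 : ℝ) < m := by exact_mod_cast hm
  positivity

theorem fockCoeff_le (n m k : ℕ) : fockCoeff n m k ≤ ((k : ℝ) + m) ^ (n + m) := by
  unfold fockCoeff
  rw [pow_add]
  gcongr
  rw [div_le_iff₀ (by positivity)]
  have h3 : (k + m).factorial ≤ (k + m) ^ m * k.factorial := by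
    have := Nat.factorial_mul_descFactorial (n := k + m) (k := m) (by omega)
    rw [← this, Nat.add_sub_cancel, mul_comm]
    exact Nat.mul_le_mul_right _ (Nat.descFactorial_le_pow _ _)
  exact_mod_cast h3

theorem summable_fockCoeff (n m : ℕ) {r : ℝ} (h0 : 0 ≤ r) (h1 : r < 1) :
    Summable fun k => fockCoeff n m k * r ^ k := by
  -- The comparison below divides by `r ^ m`, so `r = 0` is treated apart.
  rcases h0.eq_or_lt with rfl | hpos
  · refine summable_of_ne_finset_zero (s := {0}) fun k hk => ?_
    simp only [Finset.mem_singleton] at hk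
    simp [hk]
  have hs : Summable fun k : ℕ => ((k + m : ℕ) : ℝ) ^ (n + m) * r ^ (k + m) :=
    (summable_nat_add_iff (f := fun k : ℕ => (k : ℝ) ^ (n + m) * r ^ k) m).2
      (summable_pow_mul_geometric_of_norm_lt_one (n + m) (by rwa [Real.norm_of_nonneg h0]))
  refine Summable.of_nonneg_of_le (fun k => ?_) (fun k => ?_) (hs.mul_right (r ^ m)⁻¹)
  · unfold fockCoeff; positivity
  · rw [pow_add r, mul_assoc, mul_inv_cancel_right₀ (by positivity)]
    push_cast
    gcongr
    exact fockCoeff_le n m k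

/-! ### The case `n = 1`: a closed form for the series -/

/-- Write `k + m = (k + m + 1) - 1` and absorb the first factor into the binomial coefficient. The
resulting binomials have generating functions that are powers of `1 / (1 - t)`. -/
theorem fockCoeff_one (m k : ℕ) : fockCoeff 1 m k =
    m.factorial * ((m + 1) * ((k + (m + 1)).choose (m + 1) : ℝ) - ((k + m).choose m : ℝ)) := by
  unfold fockCoeff
  have h1 : ((k + m).factorial : ℝ) / k.factorial = m.factorial * ((k + m).choose m : ℝ) := by
    have := Nat.add_choose_mul_factorial_mul_factorial k m
    rw [div_eq_iff (by positivity), ← this, ← Nat.choose_symm_add]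
    push_cast; ring
  have h2 : ((m : ℝ) + 1) * ((k + (m + 1)).choose (m + 1) : ℝ)
      = (k + m + 1) * ((k + m).choose m : ℝ) := by
    have := Nat.add_one_mul_choose_eq (k + m) m
    rw [← add_assoc, mul_comm]
    exact_mod_cast this.symm
  rw [h1, h2]; ring

theorem hasSum_fockCoeff_one (m : ℕ) {t : ℂ} (ht : ‖t‖ < 1) :
    HasSum (fun k => (fockCoeff 1 m k : ℂ) * t ^ k) (m.factorial * (m + t) / (1 - t) ^ (m + 2)) := by
  have hne : 1 - t ≠ 0 := by
    intro h
    rw [sub_eq_zero] at h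
    simp [← h] at ht
  have A := (hasSum_choose_mul_geometric_of_norm_lt_one (m + 1) ht).mul_left ((m : ℂ) + 1)
  have B := hasSum_choose_mul_geometric_of_norm_lt_one m ht
  have e1 : (fun k => (fockCoeff 1 m k : ℂ) * t ^ k) = fun k => (m.factorial : ℂ) *
      (((m : ℂ) + 1) * (((k + (m + 1)).choose (m + 1) : ℂ) * t ^ k)
        - ((k + m).choose m : ℂ) * t ^ k) := by
    funext k
    rw [fockCoeff_one]; push_cast; ring
  have e2 : (m.factorial : ℂ) * (m + t) / (1 - t) ^ (m + 2) = (m.factorial : ℂ) *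
      (((m : ℂ) + 1) * (1 / (1 - t) ^ (m + 1 + 1)) - 1 / (1 - t) ^ (m + 1)) := by
    rw [show m + 2 = m + 1 + 1 from rfl, pow_succ (1 - t) (m + 1)]
    field_simp
    ring
  rw [e1, e2]
  exact (A.sub B).mul_left (m.factorial : ℂ)

theorem tsum_fockCoeff_one_ne_zero {m : ℕ} (hm : 1 ≤ m) {t : ℂ} (ht : ‖t‖ < 1) :
    ∑' k, (fockCoeff 1 m k : ℂ) * t ^ k ≠ 0 := by
  rw [(hasSum_fockCoeff_one m ht).tsum_eq]
  have hne : 1 - t ≠ 0 := by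
    intro h
    rw [sub_eq_zero] at h
    simp [← h] at ht
  have h2 : (m : ℂ) + t ≠ 0 := by
    intro h
    have h3 : ‖t‖ = m := by
      rw [show t = -(m : ℂ) by linear_combination h]; simp
    have : (1 : ℝ) ≤ m := by exact_mod_cast hm
    linarith
  have : (m.factorial : ℂ) ≠ 0 := by exact_mod_cast m.factorial_ne_zero
  positivity

/-! ### The case `m = 1`: negative zeros of `∑ k^N x^k` -/

/-- The derivative of `∑ k^N x^k` on the unit interval. -/
theorem hasDerivAt_tsum_pow_mul_geometric (N : ℕ) {x : ℝ} (hx : |x| < 1) :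
    HasDerivAt (fun y : ℝ => ∑' k : ℕ, (k : ℝ) ^ N * y ^ k)
      (∑' k : ℕ, (k : ℝ) ^ N * (k * x ^ (k - 1))) x := by
  obtain ⟨r, hxr, hr1⟩ := exists_between hx
  have hr0 : 0 < r := (abs_nonneg x).trans_lt hxr
  have hu : Summable fun k : ℕ => (k : ℝ) ^ (N + 1) * r ^ k * r⁻¹ :=
    Summable.mul_right r⁻¹ (summable_pow_mul_geometric_of_norm_lt_one (N + 1)
      (by rwa [Real.norm_of_nonneg hr0.le]))
  have h0 : Summable fun k : ℕ => (k : ℝ) ^ N * (0 : ℝ) ^ k :=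
    summable_pow_mul_geometric_of_norm_lt_one N (by simp)
  have hb : ∀ (k : ℕ), ∀ y ∈ Metric.ball (0 : ℝ) r,
      ‖(k : ℝ) ^ N * (k * y ^ (k - 1))‖ ≤ (k : ℝ) ^ (N + 1) * r ^ k * r⁻¹ := by
    intro k y hy
    have hy' : |y| ≤ r := by simpa using (Metric.mem_ball.1 hy).le
    rcases k with _ | k
    · simp
    · rw [pow_succ r, mul_assoc, mul_inv_cancel_right₀ hr0.ne', pow_succ _ N, mul_assoc]
      simp only [norm_mul, norm_pow, Real.norm_eq_abs, Nat.add_sub_cancel, Nat.abs_cast]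
      gcongr
  have hd : ∀ (k : ℕ), ∀ y ∈ Metric.ball (0 : ℝ) r, HasDerivAt (fun y : ℝ => (k : ℝ) ^ N * y ^ k)
      ((k : ℝ) ^ N * (k * y ^ (k - 1))) y := fun k y _ => (hasDerivAt_pow k y).const_mul _
  exact hasDerivAt_tsum_of_isPreconnected hu Metric.isOpen_ball
    (convex_ball (0 : ℝ) r).isPreconnected hd hb (Metric.mem_ball_self hr0) h0 (by simpa using hxr)

/-- Induction on `N`: the operator `x d/dx` raises the exponent by one, and Rolle's theorem between
a negative zero and `0` supplies the next zero. -/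
theorem exists_tsum_pow_mul_geometric_eq_zero (N : ℕ) (hN : 3 ≤ N) :
    ∃ x : ℝ, -1 < x ∧ x < 0 ∧ ∑' k : ℕ, (k : ℝ) ^ N * x ^ k = 0 := by
  induction N, hN using Nat.le_induction with
  | base =>
    have h3 : √3 ^ 2 = 3 := Real.sq_sqrt (by norm_num)
    have h3' : 0 ≤ √3 := Real.sqrt_nonneg 3
    -- The sum for `N = 3` is `x (1 + 4x + x²) / (1 - x)^4`, and `√3 - 2` is the root of the
    -- quadratic in `(-1, 0)`.
    refine ⟨√3 - 2, by nlinarith, by nlinarith, ?_⟩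
    set x := √3 - 2 with hx
    have hq : 1 + 4 * x + x ^ 2 = 0 := by rw [hx]; linear_combination h3
    have hn : ‖x‖ < 1 := by
      rw [Real.norm_eq_abs, abs_lt]
      constructor <;> nlinarith
    have hne : 1 - x ≠ 0 := by intro h; nlinarith
    have A := fun j => hasSum_choose_mul_geometric_of_norm_lt_one j hn
    -- Coefficients of `k³` in the basis `(k+j).choose j`, for `j = 3, 2, 1, 0`: `6, -12, 7, -1`.
    have S := ((((A 3).mul_left 6).sub ((A 2).mul_left 12)).add ((A 1).mul_left 7)).sub (A 0)
    have e : (fun k : ℕ => (k : ℝ) ^ 3 * x ^ k) = fun k : ℕ =>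
        6 * (((k + 3).choose 3 : ℝ) * x ^ k) - 12 * (((k + 2).choose 2 : ℝ) * x ^ k)
          + 7 * (((k + 1).choose 1 : ℝ) * x ^ k) - ((k + 0).choose 0 : ℝ) * x ^ k := by
      funext k
      have c2 : ((k + 2).choose 2 : ℝ) = (k + 2) * (k + 1) / 2 := by
        rw [Nat.cast_choose_two]; push_cast; ring
      have c3 : ((k + 3).choose 3 : ℝ) = (k + 3) * (k + 2) * (k + 1) / 6 := by
        have := Nat.add_one_mul_choose_eq (k + 2) 2
        have t : ((k : ℝ) + 2 + 1) * ((k + 2).choose 2 : ℝ) = ((k + 3).choose 3 : ℝ) * (2 + 1) := by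
          exact_mod_cast this
        rw [c2] at t
        linarith
      rw [c2, c3]
      simp only [Nat.choose_one_right, Nat.choose_zero_right]
      push_cast; ring
    rw [e, S.tsum_eq]
    have : 6 * (1 / (1 - x) ^ (3 + 1)) - 12 * (1 / (1 - x) ^ (2 + 1)) + 7 * (1 / (1 - x) ^ (1 + 1))
        - 1 / (1 - x) ^ (0 + 1) = x * (1 + 4 * x + x ^ 2) / (1 - x) ^ 4 := by
      clear_value x
      field_simp
      ring
    rw [this, hq, mul_zero, zero_div]
  | succ N hN ih =>
    obtain ⟨x, hx1, hx0, hx⟩ := ih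
    have hd : ∀ y : ℝ, x ≤ y → y ≤ 0 → |y| < 1 := fun y h1 h2 => by rw [abs_lt]; constructor <;> linarith
    obtain ⟨c, ⟨hc1, hc0⟩, hc⟩ := exists_hasDerivAt_eq_zero hx0
      (f := fun y : ℝ => ∑' k : ℕ, (k : ℝ) ^ N * y ^ k)
      (fun y hy => (hasDerivAt_tsum_pow_mul_geometric N
        (hd y hy.1 hy.2)).continuousAt.continuousWithinAt)
      (by
        rw [hx, eq_comm]
        refine (tsum_congr fun k => ?_).trans tsum_zero
        rcases k with _ | k
        · simp; omega
        · simp)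
      (fun y hy => hasDerivAt_tsum_pow_mul_geometric N (hd y hy.1.le hy.2.le))
    refine ⟨c, by linarith, hc0, ?_⟩
    have : (fun k : ℕ => (k : ℝ) ^ (N + 1) * c ^ k)
        = fun k : ℕ => c * ((k : ℝ) ^ N * (k * c ^ (k - 1))) := by
      funext k
      rcases k with _ | k
      · simp
      · simp only [Nat.add_sub_cancel]; ring
    rw [this, tsum_mul_left, hc, mul_zero]

theorem exists_tsum_fockCoeff_eq_zero {n : ℕ} (hn : 2 ≤ n) :
    ∃ x : ℝ, -1 < x ∧ x < 0 ∧ ∑' k, (fockCoeff n 1 k : ℂ) * (x : ℂ) ^ k = 0 := by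
  obtain ⟨x, hx1, hx0, hx⟩ := exists_tsum_pow_mul_geometric_eq_zero (n + 1) (by omega)
  refine ⟨x, hx1, hx0, ?_⟩
  have hs : Summable fun k : ℕ => (k : ℝ) ^ (n + 1) * x ^ k :=
    summable_pow_mul_geometric_of_norm_lt_one _ (by rw [Real.norm_eq_abs, abs_lt]; constructor <;> linarith)
  -- The `k = 0` term vanishes. After the index shift, the coefficient `(k+1)^(n+1)` is `fockCoeff n
  -- 1 k`, and a factor `x ≠ 0` comes out.
  rw [hs.tsum_eq_zero_add] at hx
  have e : ∀ k : ℕ, ((k + 1 : ℕ) : ℝ) ^ (n + 1) * x ^ (k + 1) = x * (fockCoeff n 1 k * x ^ k) := by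
    intro k
    unfold fockCoeff
    have : (k.factorial : ℝ) ≠ 0 := by positivity
    rw [Nat.factorial_succ]
    push_cast
    field_simp
    ring
  simp_rw [e, tsum_mul_left] at hx
  simp only [CharP.cast_eq_zero, ne_eq, Nat.add_eq_zero_iff, one_ne_zero, and_false,
    not_false_eq_true, zero_pow, pow_zero, mul_one, zero_add, mul_eq_zero, hx0.ne, false_or] at hx
  have := congrArg (fun y : ℝ => (y : ℂ)) hx
  push_cast at this
  exact this

/-! ### Gaussian integrals and the norms of the monomials `ζᵢ^k` -/

theorem integral_norm_pow_mul_exp_neg (q : ℕ) {b : ℝ} (hb : 0 < b) :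
    ∫ x : ℂ, ‖x‖ ^ (2 * q) * Real.exp (-b * ‖x‖ ^ 2) = Real.pi * q.factorial / b ^ (q + 1) := by
  have h := Complex.integral_rpow_mul_exp_neg_mul_rpow (p := 2) (q := ((2 * q : ℕ) : ℝ)) (b := b)
    (by norm_num) (by have : (0 : ℝ) ≤ ((2 * q : ℕ) : ℝ) := Nat.cast_nonneg _; linarith) hb
  have e1 : (((2 * q : ℕ) : ℝ) + 2) / 2 = (q : ℝ) + 1 := by push_cast; ring
  have e2 : -(((2 * q : ℕ) : ℝ) + 2) / 2 = -((q + 1 : ℕ) : ℝ) := by push_cast; ring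
  rw [e1, e2, Real.Gamma_nat_eq_factorial, Real.rpow_neg hb.le, Real.rpow_natCast] at h
  have e3 : ∀ x : ℂ, ‖x‖ ^ (2 : ℝ) = ‖x‖ ^ 2 := fun x => Real.rpow_natCast _ 2
  simp_rw [Real.rpow_natCast, e3] at h
  rw [h]
  field_simp

theorem lintegral_prod_norm_pow_mul_exp_neg {ι : Type*} [Fintype ι] (q : ι → ℕ) {b : ℝ}
    (hb : 0 < b) :
    ∫⁻ x : ι → ℂ, ENNReal.ofReal (∏ j, (‖x j‖ ^ (2 * q j) * Real.exp (-b * ‖x j‖ ^ 2)))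
      = ENNReal.ofReal (∏ j, (Real.pi * (q j).factorial / b ^ (q j + 1))) := by
  have hi : ∀ j, Integrable fun x : ℂ => ‖x‖ ^ (2 * q j) * Real.exp (-b * ‖x‖ ^ 2) := by
    intro j
    -- A non-integrable function would have Bochner integral `0`, whereas the computed value is
    -- positive.
    by_contra h
    have h1 := integral_undef h
    rw [integral_norm_pow_mul_exp_neg _ hb] at h1
    have : 0 < Real.pi * (q j).factorial / b ^ (q j + 1) := by positivity
    exact this.ne' h1
  have hi' : Integrable fun x : ι → ℂ => ∏ j, (‖x j‖ ^ (2 * q j) * Real.exp (-b * ‖x j‖ ^ 2)) :=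
    Integrable.fintype_prod hi
  rw [← ofReal_integral_eq_lintegral_ofReal hi'
    (Filter.Eventually.of_forall fun x => Finset.prod_nonneg fun j _ => by positivity)]
  congr 1
  rw [integral_fintype_prod_volume_eq_prod
    (fun j (x : ℂ) => ‖x‖ ^ (2 * q j) * Real.exp (-b * ‖x‖ ^ 2))]
  exact Finset.prod_congr rfl fun j _ => integral_norm_pow_mul_exp_neg _ hb

theorem lintegral_exp_neg_sum_norm_sq (n : ℕ) {b : ℝ} (hb : 0 < b) :
    ∫⁻ x : Fin n → ℂ, ENNReal.ofReal (Real.exp (-b * ∑ i, ‖x i‖ ^ 2))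
      = ENNReal.ofReal ((Real.pi / b) ^ n) := by
  have h := lintegral_prod_norm_pow_mul_exp_neg (ι := Fin n) (fun _ => 0) hb
  simpa [← Real.exp_sum, Finset.mul_sum, div_pow] using h

theorem lintegral_norm_pow_mul_exp_neg_sum_norm_sq {m : ℕ} (i : Fin m) (k : ℕ) :
    ∫⁻ x : Fin m → ℂ, ENNReal.ofReal (‖x i‖ ^ (2 * k) * Real.exp (-∑ j, ‖x j‖ ^ 2))
      = ENNReal.ofReal (Real.pi ^ m * k.factorial) := by
  have h := lintegral_prod_norm_pow_mul_exp_neg (ι := Fin m) (fun j => if j = i then k else 0)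
    one_pos
  have e1 : ∀ x : Fin m → ℂ, ∏ j, ‖x j‖ ^ (2 * if j = i then k else 0) = ‖x i‖ ^ (2 * k) := by
    intro x
    rw [Finset.prod_eq_single i (by intro j _ hj; simp [hj]) (by simp)]
    simp
  have e2 : ∏ j, (((if j = i then k else 0).factorial : ℕ) : ℝ) = k.factorial := by
    rw [Finset.prod_eq_single i (by intro j _ hj; simp [hj]) (by simp)]
    simp
  simp_rw [Finset.prod_mul_distrib, e1, one_pow, div_one, Finset.prod_mul_distrib, e2] at h
  simpa [← Real.exp_sum] using h

theorem measurable_sum_norm_sq (m : ℕ) : Measurable fun x : Fin m → ℂ => ∑ j, ‖x j‖ ^ 2 := by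
  fun_prop

/-- Scaling of the moments of `x i` over Euclidean balls of squared radius `t`. -/
theorem setLIntegral_norm_pow_scale {m : ℕ} (i : Fin m) (k : ℕ) {t : ℝ} (ht : 0 < t) :
    ∫⁻ x in {x : Fin m → ℂ | ∑ j, ‖x j‖ ^ 2 < t}, ENNReal.ofReal (‖x i‖ ^ (2 * k))
      = ENNReal.ofReal (t ^ (k + m)) *
        ∫⁻ x in {x : Fin m → ℂ | ∑ j, ‖x j‖ ^ 2 < 1}, ENNReal.ofReal (‖x i‖ ^ (2 * k)) := by
  have hS : ∀ s : ℝ, MeasurableSet {x : Fin m → ℂ | ∑ j, ‖x j‖ ^ 2 < s} := fun s =>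
    measurableSet_lt (measurable_sum_norm_sq m) measurable_const
  have hr : 0 < √t := Real.sqrt_pos.2 ht
  have hr2 : √t ^ 2 = t := Real.sq_sqrt ht.le
  set g : (Fin m → ℂ) → ENNReal := Set.indicator {x | ∑ j, ‖x j‖ ^ 2 < t}
    fun x => ENNReal.ofReal (‖x i‖ ^ (2 * k)) with hg
  have hgm : Measurable g := Measurable.indicator (by fun_prop) (hS t)
  -- The real dimension is `2m`, so dilation by `√t` scales volume by `t ^ m`.
  have h1 : ∫⁻ x, g (√t • x) = ENNReal.ofReal ((t ^ m)⁻¹) * ∫⁻ x, g x := by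
    rw [← lintegral_map (μ := volume) (g := fun x : Fin m → ℂ => √t • x) hgm
      (measurable_const_smul _), Measure.map_addHaar_smul _ hr.ne', lintegral_smul_measure]
    simp only [Module.finrank_pi_fintype, Complex.finrank_real_complex, Finset.sum_const,
      Finset.card_univ, Fintype.card_fin, smul_eq_mul]
    rw [mul_comm m 2, pow_mul, hr2, abs_of_pos (by positivity)]
  have h2 : ∀ x, g (√t • x) = ENNReal.ofReal (t ^ k) *
      Set.indicator {x : Fin m → ℂ | ∑ j, ‖x j‖ ^ 2 < 1}
        (fun x => ENNReal.ofReal (‖x i‖ ^ (2 * k))) x := by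
    intro x
    have hsum : ∑ j, ‖(√t • x) j‖ ^ 2 = t * ∑ j, ‖x j‖ ^ 2 := by
      rw [Finset.mul_sum]
      refine Finset.sum_congr rfl fun j _ => ?_
      rw [Pi.smul_apply, norm_smul, mul_pow, Real.norm_of_nonneg hr.le, hr2]
    have hmem : √t • x ∈ {x : Fin m → ℂ | ∑ j, ‖x j‖ ^ 2 < t} ↔
        x ∈ {x : Fin m → ℂ | ∑ j, ‖x j‖ ^ 2 < 1} := by
      simp only [Set.mem_ofPred_eq, hsum]
      constructor <;> intro h <;> nlinarith
    by_cases hx : x ∈ {x : Fin m → ℂ | ∑ j, ‖x j‖ ^ 2 < 1}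
    · rw [hg, Set.indicator_of_mem (hmem.2 hx), Set.indicator_of_mem hx,
        ← ENNReal.ofReal_mul (by positivity), Pi.smul_apply, norm_smul, mul_pow,
        Real.norm_of_nonneg hr.le, pow_mul, hr2]
    · rw [hg, Set.indicator_of_notMem (fun h => hx (hmem.1 h)), Set.indicator_of_notMem hx, mul_zero]
  simp_rw [h2] at h1
  rw [lintegral_const_mul _ (Measurable.indicator (by fun_prop) (hS 1)),
    lintegral_indicator (hS 1)] at h1
  rw [← lintegral_indicator (hS t), pow_add, ENNReal.ofReal_mul (by positivity),
    mul_comm (ENNReal.ofReal (t ^ k)), mul_assoc, h1, ← mul_assoc,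
    ← ENNReal.ofReal_mul (by positivity), mul_inv_cancel₀ (by positivity)]
  simp [hg]

theorem lintegral_exp_neg_Ioi (a : ℝ) :
    ∫⁻ t in Set.Ioi a, ENNReal.ofReal (Real.exp (-t)) = ENNReal.ofReal (Real.exp (-a)) := by
  rw [← ofReal_integral_eq_lintegral_ofReal (integrableOn_exp_neg_Ioi a)
    (Filter.Eventually.of_forall fun x => (Real.exp_pos _).le), integral_exp_neg_Ioi]

theorem lintegral_pow_mul_exp_neg (N : ℕ) :
    ∫⁻ t in Set.Ioi (0 : ℝ), ENNReal.ofReal (Real.exp (-t) * t ^ N)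
      = ENNReal.ofReal N.factorial := by
  have h1 := Real.GammaIntegral_convergent (s := N + 1) (by positivity)
  have h2 := Real.Gamma_eq_integral (s := N + 1) (by positivity)
  simp only [add_sub_cancel_right, Real.rpow_natCast, Real.Gamma_nat_eq_factorial] at h1 h2
  rw [h2, ofReal_integral_eq_lintegral_ofReal h1]
  filter_upwards [ae_restrict_mem measurableSet_Ioi] with t ht
  have : (0 : ℝ) < t := ht
  positivity

/-- The moments of a coordinate over the Euclidean unit ball. -/
theorem setLIntegral_unitBall_norm_pow {m : ℕ} (i : Fin m) (k : ℕ) :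
    ∫⁻ x in {x : Fin m → ℂ | ∑ j, ‖x j‖ ^ 2 < 1}, ENNReal.ofReal (‖x i‖ ^ (2 * k))
      = ENNReal.ofReal (Real.pi ^ m * k.factorial / (k + m).factorial) := by
  set B := ∫⁻ x in {x : Fin m → ℂ | ∑ j, ‖x j‖ ^ 2 < 1}, ENNReal.ofReal (‖x i‖ ^ (2 * k)) with hB
  have hG := lintegral_norm_pow_mul_exp_neg_sum_norm_sq i k
  -- Writing `exp (-‖x‖²)` as the integral of `exp (-t)` over `t > ‖x‖²` and swapping integrals
  -- turns the Gaussian moment into `B * ∫ exp (-t) t^(k+m) dt = B * (k+m)!`.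
  set T : Set ((Fin m → ℂ) × ℝ) := {p | ∑ j, ‖p.1 j‖ ^ 2 < p.2} with hT
  have hTm : MeasurableSet T :=
    measurableSet_lt ((measurable_sum_norm_sq m).comp measurable_fst) measurable_snd
  set F : (Fin m → ℂ) → ℝ → ENNReal := fun x t =>
    T.indicator (fun p => ENNReal.ofReal (‖p.1 i‖ ^ (2 * k)) * ENNReal.ofReal (Real.exp (-p.2)))
      (x, t) with hF
  have hFm : Measurable (Function.uncurry F) := by
    refine Measurable.indicator ?_ hTm
    fun_prop
  have h1 : ∀ x : Fin m → ℂ, ENNReal.ofReal (‖x i‖ ^ (2 * k) * Real.exp (-∑ j, ‖x j‖ ^ 2))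
      = ∫⁻ t, F x t := by
    intro x
    have : F x = (Set.Ioi (∑ j, ‖x j‖ ^ 2)).indicator
        fun t => ENNReal.ofReal (‖x i‖ ^ (2 * k)) * ENNReal.ofReal (Real.exp (-t)) := by
      funext t
      simp only [hF, hT, Set.indicator, Set.mem_ofPred_eq, Set.mem_Ioi]
    rw [this, lintegral_indicator measurableSet_Ioi, lintegral_const_mul _ (by fun_prop),
      lintegral_exp_neg_Ioi, ENNReal.ofReal_mul (by positivity)]
  have h2 : ∀ t : ℝ, ∫⁻ x, F x t
      = (Set.Ioi (0 : ℝ)).indicator (fun t => ENNReal.ofReal (Real.exp (-t) * t ^ (k + m)) * B) t := by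
    intro t
    have hS : MeasurableSet {x : Fin m → ℂ | ∑ j, ‖x j‖ ^ 2 < t} :=
      measurableSet_lt (measurable_sum_norm_sq m) measurable_const
    have e : (fun x => F x t) = ({x : Fin m → ℂ | ∑ j, ‖x j‖ ^ 2 < t}).indicator
        fun x => ENNReal.ofReal (‖x i‖ ^ (2 * k)) * ENNReal.ofReal (Real.exp (-t)) := by
      funext x
      simp only [hF, hT, Set.indicator, Set.mem_ofPred_eq]
    rw [e, lintegral_indicator hS, lintegral_mul_const _ (by fun_prop)]
    by_cases ht : 0 < t
    · rw [Set.indicator_of_mem (Set.mem_Ioi.2 ht), setLIntegral_norm_pow_scale i k ht,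
        ENNReal.ofReal_mul (by positivity)]
      ring
    · have : {x : Fin m → ℂ | ∑ j, ‖x j‖ ^ 2 < t} = ∅ := by
        ext x
        have : 0 ≤ ∑ j, ‖x j‖ ^ 2 := by positivity
        simp only [Set.mem_ofPred_eq, Set.mem_empty_iff_false, iff_false, not_lt]
        linarith
      rw [Set.indicator_of_notMem (by simpa using ht), this]
      simp
  simp_rw [h1] at hG
  rw [lintegral_lintegral_swap hFm.aemeasurable] at hG
  simp_rw [h2] at hG
  rw [lintegral_indicator measurableSet_Ioi, lintegral_mul_const _ (by fun_prop),
    lintegral_pow_mul_exp_neg] at hG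
  have hpos : (0 : ℝ) < (k + m).factorial := by positivity
  rw [ENNReal.ofReal_div_of_pos hpos, ← hG, mul_comm, ENNReal.mul_div_cancel_right]
  · simpa using Nat.factorial_ne_zero _
  · exact ENNReal.ofReal_ne_top

theorem isOpen_hartogsFock (μ : ℝ) (n m : ℕ) : IsOpen (hartogsFock μ n m) :=
  isOpen_lt (by fun_prop) (by fun_prop)

/-- The squared norm of `ζᵢ^k` in the Bergman space of `hartogsFock μ n m`. -/
theorem setLIntegral_hartogsFock_norm_pow {μ : ℝ} (hμ : 0 < μ) (n : ℕ) {m : ℕ} (i : Fin m)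
    (k : ℕ) :
    ∫⁻ p in hartogsFock μ n m, ENNReal.ofReal (‖p.2 i‖ ^ (2 * k))
      = ENNReal.ofReal (Real.pi ^ (n + m) / μ ^ n * (fockCoeff n m k)⁻¹) := by
  have hm : 1 ≤ m := by have := i.2; omega
  have hkm : (0 : ℝ) < (k : ℝ) + m := by
    have : (1 : ℝ) ≤ m := by exact_mod_cast hm
    positivity
  have hD := (isOpen_hartogsFock μ n m).measurableSet
  rw [← lintegral_indicator hD, Measure.volume_eq_prod,
    lintegral_prod _ (Measurable.indicator (by fun_prop) hD).aemeasurable]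
  -- The fibre over `z` is a ball of squared radius `exp (-μ‖z‖²)`. Scaling turns its moment into a
  -- Gaussian in `z` with rate `μ (k + m)`, the source of the factor `(k + m)^n`.
  have h : ∀ z : Fin n → ℂ, ∫⁻ w : Fin m → ℂ, (hartogsFock μ n m).indicator
      (fun p => ENNReal.ofReal (‖p.2 i‖ ^ (2 * k))) (z, w)
      = ENNReal.ofReal (Real.exp (-(μ * (k + m)) * ∑ i, ‖z i‖ ^ 2)) *
        ENNReal.ofReal (Real.pi ^ m * k.factorial / (k + m).factorial) := by
    intro z
    have e : (fun w : Fin m → ℂ => (hartogsFock μ n m).indicator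
      (fun p => ENNReal.ofReal (‖p.2 i‖ ^ (2 * k))) (z, w)) =
        ({w : Fin m → ℂ | ∑ j, ‖w j‖ ^ 2 < Real.exp (-μ * ∑ i, ‖z i‖ ^ 2)}).indicator
          fun w => ENNReal.ofReal (‖w i‖ ^ (2 * k)) := by
      funext w
      simp only [hartogsFock, Set.indicator, Set.mem_ofPred_eq]
    rw [e, lintegral_indicator (measurableSet_lt (measurable_sum_norm_sq m) measurable_const),
      setLIntegral_norm_pow_scale i k (Real.exp_pos _), setLIntegral_unitBall_norm_pow,
      ← Real.exp_nat_mul]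
    congr 3
    push_cast; ring
  simp_rw [h]
  rw [lintegral_mul_const _ (by fun_prop), lintegral_exp_neg_sum_norm_sq n (by positivity),
    ← ENNReal.ofReal_mul (by positivity)]
  congr 1
  unfold fockCoeff
  rw [div_pow, mul_pow, pow_add]
  field_simp

theorem isFiniteMeasure_hartogsFock {μ : ℝ} (hμ : 0 < μ) (n : ℕ) {m : ℕ} (hm : 1 ≤ m) :
    IsFiniteMeasure (volume.restrict (hartogsFock μ n m)) := by
  refine ⟨?_⟩
  -- The zeroth moment is the volume.
  have h := setLIntegral_hartogsFock_norm_pow hμ n (⟨0, hm⟩ : Fin m) 0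
  simp only [mul_zero, pow_zero, ENNReal.ofReal_one, lintegral_one] at h
  rw [h]
  exact ENNReal.ofReal_lt_top

theorem norm_lt_one_of_mem_hartogsFock {μ : ℝ} (hμ : 0 ≤ μ) {n m : ℕ}
    {p : (Fin n → ℂ) × (Fin m → ℂ)} (hp : p ∈ hartogsFock μ n m) (i : Fin m) : ‖p.2 i‖ < 1 := by
  have h1 : ‖p.2 i‖ ^ 2 ≤ ∑ j, ‖p.2 j‖ ^ 2 :=
    Finset.single_le_sum (f := fun j => ‖p.2 j‖ ^ 2) (fun j _ => by positivity) (Finset.mem_univ i)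
  have h2 : Real.exp (-μ * ∑ i, ‖p.1 i‖ ^ 2) ≤ 1 := by
    rw [Real.exp_le_one_iff]
    have : 0 ≤ ∑ i, ‖p.1 i‖ ^ 2 := by positivity
    nlinarith
  have h3 : ‖p.2 i‖ ^ 2 < 1 := (h1.trans_lt hp).trans_le h2
  exact (sq_lt_one_iff₀ (norm_nonneg _)).1 h3

theorem setIntegral_hartogsFock_norm_pow {μ : ℝ} (hμ : 0 < μ) (n : ℕ) {m : ℕ} (i : Fin m)
    (k : ℕ) :
    ∫ p in hartogsFock μ n m, ‖p.2 i‖ ^ (2 * k)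
      = Real.pi ^ (n + m) / μ ^ n * (fockCoeff n m k)⁻¹ := by
  rw [integral_eq_lintegral_of_nonneg_ae (Filter.Eventually.of_forall fun p => by positivity)
    (by fun_prop), setLIntegral_hartogsFock_norm_pow hμ,
    ENNReal.toReal_ofReal]
  unfold fockCoeff
  positivity

/-! ### Circle averages and Taylor coefficients -/

/-- Averaging over a measurable family of measure preserving transformations indexed by the circle. -/
theorem integral_eq_integral_of_circle_average {X : Type*} [MeasurableSpace X] {ν : Measure X}
    [IsFiniteMeasure ν] {R : ℝ → X → X} (hR : Measurable (Function.uncurry R))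
    (hmp : ∀ θ, MeasurePreserving (R θ) ν ν) {G H : X → ℂ} (hG : Integrable G ν)
    (hH : ∀ᵐ x ∂ν, ∫ θ in (0 : ℝ)..2 * Real.pi, G (R θ x) = 2 * Real.pi * H x) :
    Integrable H ν ∧ ∫ x, G x ∂ν = ∫ x, H x ∂ν := by
  have hpi : (0 : ℝ) ≤ 2 * Real.pi := by positivity
  have hpi' : (2 * Real.pi : ℂ) ≠ 0 := by
    exact_mod_cast (by positivity : (2 * Real.pi : ℝ) ≠ 0)
  set I : Measure ℝ := volume.restrict (Set.Ioc 0 (2 * Real.pi)) with hI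
  -- The skew product preserves the product measure, which gives the joint integrability that Fubini
  -- needs.
  have hΨ : MeasurePreserving (fun p : ℝ × X => (p.1, R p.1 p.2)) (I.prod ν) (I.prod ν) :=
    (MeasurePreserving.id I).skew_product hR (Filter.Eventually.of_forall fun θ => (hmp θ).map_eq)
  have hint : Integrable (Function.uncurry fun (θ : ℝ) (x : X) => G (R θ x)) (I.prod ν) :=
    hΨ.integrable_comp_of_integrable (hG.comp_snd I)
  have h1 : ∀ θ, ∫ x, G (R θ x) ∂ν = ∫ x, G x ∂ν := by
    intro θ
    have := integral_map (hmp θ).measurable.aemeasurable (f := G)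
      (by rw [(hmp θ).map_eq]; exact hG.1)
    rw [← this, (hmp θ).map_eq]
  have hH' : (fun x => ∫ θ, G (R θ x) ∂I) =ᵐ[ν] fun x => 2 * Real.pi * H x := by
    filter_upwards [hH] with x hx
    rw [← hx, intervalIntegral.integral_of_le hpi]
  have hsw := integral_integral_swap hint
  simp_rw [h1] at hsw
  rw [integral_congr_ae hH', integral_const_mul, integral_const] at hsw
  -- Integrability of `H` is part of the conclusion so that a second average can be applied to `H`.
  refine ⟨?_, ?_⟩
  · have h2 : Integrable (fun x => 2 * Real.pi * H x) ν :=
      hint.integral_prod_right.congr hH'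
    have h3 := h2.const_mul (2 * Real.pi : ℂ)⁻¹
    simpa [← mul_assoc, inv_mul_cancel₀ hpi'] using h3
  · have h4 : I.real Set.univ = 2 * Real.pi := by
      simp [hI, Measure.real, Real.pi_pos.le]
    rw [h4, Complex.real_smul] at hsw
    push_cast at hsw
    exact mul_left_cancel₀ hpi' hsw

theorem measurePreserving_mul_of_norm_eq_one {u : ℂ} (hu : ‖u‖ = 1) :
    MeasurePreserving (fun x : ℂ => u * x) :=
  (rotation ⟨u, mem_sphere_zero_iff_norm.2 hu⟩).measurePreserving

/-- The torus acts on `hartogsFock μ n m` by measure preserving maps. -/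
theorem measurePreserving_torus (μ : ℝ) {n m : ℕ} {u : Fin n → ℂ} {v : Fin m → ℂ}
    (hu : ∀ i, ‖u i‖ = 1) (hv : ∀ j, ‖v j‖ = 1) :
    MeasurePreserving (fun p : (Fin n → ℂ) × (Fin m → ℂ) =>
        ((fun i => u i * p.1 i, fun j => v j * p.2 j) : (Fin n → ℂ) × (Fin m → ℂ)))
      (volume.restrict (hartogsFock μ n m)) (volume.restrict (hartogsFock μ n m)) := by
  have h : MeasurePreserving (fun p : (Fin n → ℂ) × (Fin m → ℂ) =>
        ((fun i => u i * p.1 i, fun j => v j * p.2 j) : (Fin n → ℂ) × (Fin m → ℂ)))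
        volume volume :=
    (volume_preserving_pi fun i => measurePreserving_mul_of_norm_eq_one (hu i)).prod
      (volume_preserving_pi fun j => measurePreserving_mul_of_norm_eq_one (hv j))
  have h2 := h.restrict_preimage (isOpen_hartogsFock μ n m).measurableSet
  convert h2 using 2
  ext p
  simp [hartogsFock, hu, hv]

/-- The domain is complete Reinhardt, so the closed discs used for the mean value property stay
inside it. -/
theorem mem_hartogsFock_of_norm_le {μ : ℝ} (hμ : 0 ≤ μ) {n m : ℕ}
    {p q : (Fin n → ℂ) × (Fin m → ℂ)} (hp : p ∈ hartogsFock μ n m)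
    (h1 : ∀ i, ‖q.1 i‖ ≤ ‖p.1 i‖) (h2 : ∀ j, ‖q.2 j‖ ≤ ‖p.2 j‖) : q ∈ hartogsFock μ n m := by
  have a1 : ∑ i, ‖q.1 i‖ ^ 2 ≤ ∑ i, ‖p.1 i‖ ^ 2 := Finset.sum_le_sum fun i _ => by gcongr; exact h1 i
  have a2 : ∑ i, ‖q.2 i‖ ^ 2 ≤ ∑ i, ‖p.2 i‖ ^ 2 := Finset.sum_le_sum fun i _ => by gcongr; exact h2 i
  refine (a2.trans_lt hp).trans_le (Real.exp_le_exp.2 ?_)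
  nlinarith

theorem single_mem_hartogsFock (μ : ℝ) (n : ℕ) {m : ℕ} (i : Fin m) {w : ℂ} (hw : ‖w‖ < 1) :
    ((0, Pi.single i w) : (Fin n → ℂ) × (Fin m → ℂ)) ∈ hartogsFock μ n m := by
  have : ∑ j, ‖(Pi.single i w : Fin m → ℂ) j‖ ^ 2 = ‖w‖ ^ 2 := by
    rw [Finset.sum_eq_single i (by intro j _ hj; simp [hj]) (by simp)]
    simp
  simp only [hartogsFock, Set.mem_ofPred_eq, this]
  simpa using hw

theorem MemBergman.integrable {E : Type*} [NormedAddCommGroup E] [NormedSpace ℂ E] [MeasureSpace E]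
    {Ω : Set E} [IsFiniteMeasure (volume.restrict Ω)] {f : E → ℂ} (hf : MemBergman Ω f) :
    IntegrableOn f Ω :=
  hf.2.integrable (by norm_num)

theorem differentiableOn_slice {μ : ℝ} {n m : ℕ} (i : Fin m) {f : (Fin n → ℂ) × (Fin m → ℂ) → ℂ}
    (hf : DifferentiableOn ℂ f (hartogsFock μ n m)) :
    DifferentiableOn ℂ (fun w : ℂ => f (0, Pi.single i w)) (Metric.ball 0 1) := by
  refine hf.comp (f := fun w : ℂ => ((0, Pi.single i w) : (Fin n → ℂ) × (Fin m → ℂ))) ?_ ?_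
  · refine (Differentiable.prodMk (differentiable_const _) ?_).differentiableOn
    exact (ContinuousLinearMap.single ℂ (fun _ : Fin m => ℂ) i).differentiable
  · intro w hw
    exact single_mem_hartogsFock μ n i (by simpa using hw)

/-- The circle average of `g (l w) conj(l w)^k` over `|l| = 1` picks the `k`-th Taylor term of `g`. -/
theorem integral_circle_mul_conj_pow {g : ℂ → ℂ} (hg : DifferentiableOn ℂ g (Metric.ball 0 1))
    {w : ℂ} (hw : ‖w‖ < 1) (k : ℕ) :
    ∫ θ in (0 : ℝ)..2 * Real.pi, g (circleMap 0 1 θ * w) *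
        starRingEnd ℂ (circleMap 0 1 θ * w) ^ k
      = 2 * Real.pi * ((k.factorial : ℂ)⁻¹ * iteratedDeriv k g 0 * ((‖w‖ ^ (2 * k) : ℝ) : ℂ)) := by
  have hmaps : Set.MapsTo (w * ·) (Metric.ball (0 : ℂ) 1) (Metric.ball 0 1) := by
    intro x hx
    simp only [Metric.mem_ball, dist_zero_right] at hx ⊢
    rw [norm_mul]
    exact mul_lt_one_of_nonneg_of_lt_one_left (norm_nonneg _) hw hx.le
  have hd : DifferentiableOn ℂ (fun x => g (w * x)) (Metric.closedBall 0 1) := by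
    refine hg.comp (by fun_prop) fun x hx => ?_
    simp only [Metric.mem_ball, Metric.mem_closedBall, dist_zero_right] at hx ⊢
    rw [norm_mul]
    exact mul_lt_one_of_nonneg_of_lt_one_left (norm_nonneg _) hw hx
  have hcd : ContDiffOn ℂ k g (Metric.ball 0 1) := hg.contDiffOn Metric.isOpen_ball
  have h0 : (0 : ℂ) ∈ Metric.ball (0 : ℂ) 1 := Metric.mem_ball_self one_pos
  -- Cauchy's formula is applied to `x ↦ g (w * x)`, where `conj x = x⁻¹` on the unit circle. Its
  -- `k`-th derivative at `0` carries `w ^ k`, which pairs with `conj w ^ k` to give `‖w‖ ^ (2k)`.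
  have hder := iteratedDerivWithin_comp_const_smul (x := 0) h0
    (Metric.isOpen_ball.uniqueDiffOn) hcd w hmaps
  rw [iteratedDerivWithin_of_isOpen Metric.isOpen_ball h0,
    mul_zero, iteratedDerivWithin_of_isOpen Metric.isOpen_ball h0, smul_eq_mul] at hder
  have hC := hd.circleIntegral_one_div_sub_center_pow_smul one_pos k
  rw [hder, circleIntegral] at hC
  have e : ∀ θ : ℝ, g (circleMap 0 1 θ * w) * starRingEnd ℂ (circleMap 0 1 θ * w) ^ k
      = (-Complex.I * starRingEnd ℂ w ^ k) * (deriv (circleMap 0 1) θ •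
        ((1 / (circleMap 0 1 θ - 0) ^ (k + 1)) • g (w * circleMap 0 1 θ))) := by
    intro θ
    have hn : ‖circleMap 0 1 θ‖ = 1 := by simp
    have hne : circleMap 0 1 θ ≠ 0 := by
      intro h
      simp [h] at hn
    have hconj : starRingEnd ℂ (circleMap 0 1 θ) = (circleMap 0 1 θ)⁻¹ := by
      rw [Complex.inv_def, Complex.normSq_eq_norm_sq, hn]; simp
    rw [deriv_circleMap, map_mul, mul_pow, hconj, inv_pow, sub_zero, mul_comm w, pow_succ]
    simp only [smul_eq_mul]
    field_simp
    linear_combination (g (circleMap 0 1 θ * w) * starRingEnd ℂ w ^ k) * Complex.I_sq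
  simp_rw [e]
  rw [intervalIntegral.integral_const_mul, hC]
  have hw2 : starRingEnd ℂ w ^ k * w ^ k = ((‖w‖ ^ (2 * k) : ℝ) : ℂ) := by
    rw [← mul_pow, mul_comm, Complex.mul_conj, Complex.normSq_eq_norm_sq, pow_mul]
    push_cast; rfl
  rw [← hw2, smul_eq_mul]
  field_simp
  linear_combination (-(k.factorial : ℂ)⁻¹ * starRingEnd ℂ w ^ k * w ^ k * iteratedDeriv k g 0) *
    Complex.I_sq

/-- Two circle averages replace a multivariable power series. Rotating every coordinate except `ζᵢ`
fixes the conjugate factor and, by the mean value property, replaces `f` by its slice on the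
`ζᵢ`-axis. Rotating `ζ` then isolates one Taylor coefficient of the slice. -/
theorem setIntegral_hartogsFock_mul_conj_pow {μ : ℝ} (hμ : 0 < μ) {n m : ℕ} (i : Fin m)
    {f : (Fin n → ℂ) × (Fin m → ℂ) → ℂ} (hf : MemBergman (hartogsFock μ n m) f) (k : ℕ) :
    ∫ p in hartogsFock μ n m, f p * starRingEnd ℂ (p.2 i) ^ k
      = (k.factorial : ℂ)⁻¹ * iteratedDeriv k (fun w : ℂ => f (0, Pi.single i w)) 0 *
        ((Real.pi ^ (n + m) / μ ^ n * (fockCoeff n m k)⁻¹ : ℝ) : ℂ) := by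
  have hm : 1 ≤ m := by have := i.2; omega
  have := isFiniteMeasure_hartogsFock hμ n hm
  have hD := (isOpen_hartogsFock μ n m).measurableSet
  set g : ℂ → ℂ := fun w => f (0, Pi.single i w) with hg
  have hgd : DifferentiableOn ℂ g (Metric.ball 0 1) := differentiableOn_slice i hf.1
  have hG : Integrable (fun p : (Fin n → ℂ) × (Fin m → ℂ) => f p * starRingEnd ℂ (p.2 i) ^ k)
      (volume.restrict (hartogsFock μ n m)) := by
    refine hf.integrable.mul_bdd (c := 1) ?_ ?_
    · exact Continuous.aestronglyMeasurable (by fun_prop)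
    · filter_upwards [ae_restrict_mem hD] with p hp
      rw [norm_pow, RCLike.norm_conj]
      exact pow_le_one₀ (norm_nonneg _) (norm_lt_one_of_mem_hartogsFock hμ.le hp i).le
  obtain ⟨i1, e1⟩ := integral_eq_integral_of_circle_average
    (R := fun (θ : ℝ) (p : (Fin n → ℂ) × (Fin m → ℂ)) =>
      ((fun a => circleMap 0 1 θ * p.1 a, fun j => (if j = i then 1 else circleMap 0 1 θ) * p.2 j) :
        (Fin n → ℂ) × (Fin m → ℂ)))
    (H := fun p => g (p.2 i) * starRingEnd ℂ (p.2 i) ^ k)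
    (by
      refine Measurable.prodMk ?_ ?_
      · fun_prop
      · refine measurable_pi_lambda _ fun j => ?_
        by_cases h : j = i
        · simp only [h, if_true]; fun_prop
        · simp only [h, if_false]; fun_prop)
    (fun θ => measurePreserving_torus μ (fun _ => by simp) (fun j => by split_ifs <;> simp)) hG
    (by
      filter_upwards [ae_restrict_mem hD] with p hp
      simp only [if_true, one_mul, intervalIntegral.integral_mul_const]
      rw [← mul_assoc]
      congr 1
      -- `φ` extends the rotated function holomorphically to the disc, and its centre value is the
      -- slice at `ζᵢ`.
      set φ : ℂ → ℂ := fun l => f (fun a => l * p.1 a, fun j => (if j = i then 1 else l) * p.2 j)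
        with hφ
      have hφd : DifferentiableOn ℂ φ (Metric.closedBall 0 1) := by
        refine hf.1.comp (f := fun l : ℂ => ((fun a => l * p.1 a,
          fun j => (if j = i then 1 else l) * p.2 j) : (Fin n → ℂ) × (Fin m → ℂ))) ?_ ?_
        · refine (Differentiable.prodMk (by fun_prop) ?_).differentiableOn
          refine differentiable_pi.2 fun j => ?_
          by_cases h : j = i
          · simp only [h, if_true]; fun_prop
          · simp only [h, if_false]; fun_prop
        · intro l hl
          have hl' : ‖l‖ ≤ 1 := by simpa using hl
          refine mem_hartogsFock_of_norm_le hμ.le hp (fun a => ?_) fun j => ?_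
          · simp only [norm_mul]
            exact mul_le_of_le_one_left (norm_nonneg _) hl'
          · simp only [norm_mul]
            refine mul_le_of_le_one_left (norm_nonneg _) ?_
            split_ifs <;> simp [hl']
      have hav : Real.circleAverage φ 0 1 = φ 0 := by
        refine DiffContOnCl.circleAverage ?_
        rw [abs_one]
        exact (hφd.mono Metric.closure_ball_subset_closedBall).diffContOnCl
      have hφ0 : φ 0 = g (p.2 i) := by
        simp only [hφ, hg, zero_mul]
        congr 2
        funext j
        by_cases h : j = i
        · subst h; simp
        · simp [h]
      rw [Real.circleAverage_def, hφ0] at hav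
      rw [← hav, Complex.real_smul, ← mul_assoc]
      push_cast
      rw [mul_inv_cancel₀ (by simp [Real.pi_ne_zero]), one_mul])
  obtain ⟨i2, e2⟩ := integral_eq_integral_of_circle_average
    (R := fun (θ : ℝ) (p : (Fin n → ℂ) × (Fin m → ℂ)) =>
      ((fun a => 1 * p.1 a, fun j => circleMap 0 1 θ * p.2 j) : (Fin n → ℂ) × (Fin m → ℂ)))
    (H := fun p => (k.factorial : ℂ)⁻¹ * iteratedDeriv k g 0 * ((‖p.2 i‖ ^ (2 * k) : ℝ) : ℂ))
    (by refine Measurable.prodMk ?_ ?_ <;> fun_prop)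
    (fun θ => measurePreserving_torus μ (fun _ => by simp) (fun j => by simp)) i1
    (by
      filter_upwards [ae_restrict_mem hD] with p hp
      exact integral_circle_mul_conj_pow hgd (norm_lt_one_of_mem_hartogsFock hμ.le hp i) k)
  rw [e1, e2, integral_const_mul, integral_complex_ofReal, setIntegral_hartogsFock_norm_pow hμ]

/-! ### Reproducing functions at the points `(0, s eᵢ)` -/

/-- `k` represents evaluation at `z` on the Bergman space of `Ω`. -/
def IsReproducingAt {E : Type*} [NormedAddCommGroup E] [NormedSpace ℂ E] [MeasureSpace E]
    (Ω : Set E) (z : E) (k : E → ℂ) : Prop :=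
  MemBergman Ω (fun w => starRingEnd ℂ (k w)) ∧
    ∀ f : E → ℂ, MemBergman Ω f → f z = ∫ w in Ω, f w * k w

theorem norm_fockCoeff_mul_pow_le (n m k : ℕ) {s w : ℂ} (hw : ‖w‖ ≤ 1) :
    ‖(fockCoeff n m k : ℂ) * (s * w) ^ k‖ ≤ fockCoeff n m k * ‖s‖ ^ k := by
  have h0 : 0 ≤ fockCoeff n m k := by unfold fockCoeff; positivity
  rw [norm_mul, Complex.norm_real, Real.norm_of_nonneg h0, norm_pow, norm_mul]
  gcongr
  exact mul_le_of_le_one_right (norm_nonneg _) hw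

theorem differentiableOn_tsum_fockCoeff (n m : ℕ) {s : ℂ} (hs : ‖s‖ < 1) :
    DifferentiableOn ℂ (fun w => ∑' k, (fockCoeff n m k : ℂ) * (s * w) ^ k) (Metric.ball 0 1) :=
  Complex.differentiableOn_tsum_of_summable_norm (summable_fockCoeff n m (norm_nonneg s) hs)
    (fun k => by fun_prop) Metric.isOpen_ball fun k w hw =>
      norm_fockCoeff_mul_pow_le n m k (by simpa using (Metric.mem_ball.1 hw).le)

/-- The Bergman kernel of `hartogsFock μ n m` at a point `(0, s eᵢ)`. -/
theorem isReproducingAt_single {μ : ℝ} (hμ : 0 < μ) (n : ℕ) {m : ℕ} (i : Fin m) {s : ℂ}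
    (hs : ‖s‖ < 1) :
    IsReproducingAt (hartogsFock μ n m) (0, Pi.single i s)
      fun q => ((μ ^ n / Real.pi ^ (n + m) : ℝ) : ℂ) *
        ∑' k, (fockCoeff n m k : ℂ) * (s * starRingEnd ℂ (q.2 i)) ^ k := by
  have hm : 1 ≤ m := by have := i.2; omega
  have := isFiniteMeasure_hartogsFock hμ n hm
  have hD := isOpen_hartogsFock μ n m
  set C : ℝ := μ ^ n / Real.pi ^ (n + m) with hC
  have hCpos : 0 < C := by positivity
  have hsum := summable_fockCoeff n m (norm_nonneg s) hs
  constructor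
  · have e : (fun q : (Fin n → ℂ) × (Fin m → ℂ) => starRingEnd ℂ ((C : ℂ) *
        ∑' k, (fockCoeff n m k : ℂ) * (s * starRingEnd ℂ (q.2 i)) ^ k)) =
        fun q => (C : ℂ) * ∑' k, (fockCoeff n m k : ℂ) * (starRingEnd ℂ s * q.2 i) ^ k := by
      funext q
      simp [Complex.conj_tsum]
    rw [e]
    have hs' : ‖starRingEnd ℂ s‖ < 1 := by rwa [RCLike.norm_conj]
    have hd : DifferentiableOn ℂ (fun q : (Fin n → ℂ) × (Fin m → ℂ) =>
        (C : ℂ) * ∑' k, (fockCoeff n m k : ℂ) * (starRingEnd ℂ s * q.2 i) ^ k)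
        (hartogsFock μ n m) := by
      refine DifferentiableOn.const_mul ?_ _
      exact (differentiableOn_tsum_fockCoeff n m hs').comp
        (f := fun q : (Fin n → ℂ) × (Fin m → ℂ) => q.2 i) (by fun_prop)
        fun q hq => by simpa using norm_lt_one_of_mem_hartogsFock hμ.le hq i
    refine ⟨hd, MemLp.of_bound (hd.continuousOn.aestronglyMeasurable hD.measurableSet)
      (C * ∑' k, fockCoeff n m k * ‖s‖ ^ k) ?_⟩
    filter_upwards [ae_restrict_mem hD.measurableSet] with q hq
    rw [norm_mul, Complex.norm_real, Real.norm_of_nonneg hCpos.le]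
    gcongr
    refine tsum_of_norm_bounded hsum.hasSum fun k => ?_
    have := norm_fockCoeff_mul_pow_le n m k (s := starRingEnd ℂ s)
      (norm_lt_one_of_mem_hartogsFock hμ.le hq i).le
    rwa [RCLike.norm_conj] at this
  · intro f hf
    have hint := hf.integrable
    set F : ℕ → (Fin n → ℂ) × (Fin m → ℂ) → ℂ := fun k q =>
      ((C : ℂ) * fockCoeff n m k * s ^ k) * (f q * starRingEnd ℂ (q.2 i) ^ k) with hF
    have hbd : ∀ k, ∀ᵐ q ∂(volume.restrict (hartogsFock μ n m)),
        ‖starRingEnd ℂ (q.2 i) ^ k‖ ≤ 1 := by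
      intro k
      filter_upwards [ae_restrict_mem hD.measurableSet] with q hq
      rw [norm_pow, RCLike.norm_conj]
      exact pow_le_one₀ (norm_nonneg _) (norm_lt_one_of_mem_hartogsFock hμ.le hq i).le
    have hFint : ∀ k, Integrable (F k) (volume.restrict (hartogsFock μ n m)) := fun k =>
      (hint.mul_bdd (c := 1) (Continuous.aestronglyMeasurable (by fun_prop)) (hbd k)).const_mul _
    -- On the domain `‖F k‖ ≤ C * fockCoeff n m k * ‖s‖^k * ‖f‖`, and `f` is integrable because the
    -- volume is finite. So the sum and the integral may be exchanged.
    have hFsum : Summable fun k => ∫ q in hartogsFock μ n m, ‖F k q‖ := by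
      refine Summable.of_nonneg_of_le (fun k => integral_nonneg fun q => norm_nonneg _) (fun k => ?_)
        ((hsum.mul_left C).mul_right (∫ q in hartogsFock μ n m, ‖f q‖))
      rw [← integral_const_mul]
      refine integral_mono_ae (hFint k).norm (hint.norm.const_mul _) ?_
      filter_upwards [hbd k] with q hq
      have h0 : 0 ≤ fockCoeff n m k := by unfold fockCoeff; positivity
      simp only [hF]
      rw [norm_mul, norm_mul, norm_mul, norm_mul, norm_pow s, Complex.norm_real, Complex.norm_real,
        Real.norm_of_nonneg hCpos.le, Real.norm_of_nonneg h0, ← mul_assoc C]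
      gcongr
      exact mul_le_of_le_one_right (norm_nonneg _) hq
    have h1 := hasSum_integral_of_summable_integral_norm hFint hFsum
    have h2 := Complex.hasSum_taylorSeries_on_ball (differentiableOn_slice i hf.1)
      (z := s) (by simpa using hs)
    have h3 : (fun k => ∫ q in hartogsFock μ n m, F k q) = fun k : ℕ =>
        (k.factorial : ℂ)⁻¹ • (s - 0) ^ k •
          iteratedDeriv k (fun w : ℂ => f (0, Pi.single i w)) 0 := by
      funext k
      have hk := (fockCoeff_pos hm n k).ne'
      have hne : (C * (Real.pi ^ (n + m) / μ ^ n) : ℝ) = 1 := by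
        rw [hC]; field_simp
      have hne' : (C : ℂ) * fockCoeff n m k *
          ((Real.pi ^ (n + m) / μ ^ n * (fockCoeff n m k)⁻¹ : ℝ) : ℂ) = 1 := by
        rw [← Complex.ofReal_mul, ← Complex.ofReal_mul, ← Complex.ofReal_one]
        congr 1
        rw [mul_comm (Real.pi ^ (n + m) / μ ^ n), ← mul_assoc, mul_assoc C, mul_inv_cancel₀ hk,
          mul_one, hne]
      simp only [hF]
      rw [integral_const_mul, setIntegral_hartogsFock_mul_conj_pow hμ i hf k, sub_zero,
        smul_eq_mul, smul_eq_mul]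
      linear_combination ((k.factorial : ℂ)⁻¹ * s ^ k *
        iteratedDeriv k (fun w : ℂ => f (0, Pi.single i w)) 0) * hne'
    rw [h3] at h1
    rw [h2.unique h1]
    refine integral_congr_ae (Filter.Eventually.of_forall fun q => ?_)
    simp only [hF]
    rw [← tsum_mul_left, ← tsum_mul_left]
    refine tsum_congr fun k => ?_
    rw [mul_pow]; ring

/-! ### Transport by automorphisms -/

/-- Reproducing functions are transported by biholomorphic self-maps, with complex Jacobian `J`. -/
theorem IsReproducingAt.transport {E : Type*} [NormedAddCommGroup E] [NormedSpace ℂ E]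
    [MeasureSpace E] [BorelSpace E] [SecondCountableTopology E] {Ω : Set E} (hΩ : IsOpen Ω)
    {Φ Ψ : E → E} {J : E → ℂ}
    (hΦ : Differentiable ℂ Φ) (hΨ : Differentiable ℂ Ψ) (hJ : Differentiable ℂ J)
    (hΦΨ : ∀ q, Φ (Ψ q) = q) (hΨΦ : ∀ q, Ψ (Φ q) = q) (hJ0 : ∀ q, J q ≠ 0)
    (hmem : ∀ q, Φ q ∈ Ω ↔ q ∈ Ω)
    (hmap : (volume.withDensity fun q => ‖J q‖ₑ ^ 2).map Φ = volume)
    {p : E} {k : E → ℂ} (hk : IsReproducingAt Ω p k) :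
    ∃ k' : E → ℂ, IsReproducingAt Ω (Φ p) k' ∧ ((∀ q ∈ Ω, k q ≠ 0) → ∀ q ∈ Ω, k' q ≠ 0) := by
  have hJm : Measurable fun q => ‖J q‖₊ ^ 2 := hJ.continuous.measurable.nnnorm.pow_const 2
  have hpre : Φ ⁻¹' Ω = Ω := Set.ext hmem
  have hmap' : ((volume.restrict Ω).withDensity fun q => ((‖J q‖₊ ^ 2 : NNReal) : ENNReal)).map Φ
      = volume.restrict Ω := by
    have h := Measure.restrict_map (μ := volume.withDensity fun q => ‖J q‖ₑ ^ 2)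
      hΦ.continuous.measurable hΩ.measurableSet
    rw [hmap, hpre, restrict_withDensity hΩ.measurableSet] at h
    simpa [enorm] using h.symm
  have hint : ∀ {G : E → ℂ}, ContinuousOn G Ω → ∫ q in Ω, G q = ∫ q in Ω, (‖J q‖ ^ 2) • G (Φ q) := by
    intro G hG
    have hm := hG.aestronglyMeasurable (μ := volume) hΩ.measurableSet
    rw [← hmap'] at hm
    conv_lhs => rw [← hmap']
    rw [integral_map hΦ.continuous.measurable.aemeasurable hm,
      integral_withDensity_eq_integral_smul hJm]
    rfl
  -- The real Jacobian is `‖J‖²`, so `h ↦ (h ∘ Φ) * J` preserves square integrability in both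
  -- directions.
  have hmemLp : ∀ {h : E → ℂ}, DifferentiableOn ℂ h Ω →
      (MemLp h 2 (volume.restrict Ω) ↔ MemLp (fun q => h (Φ q) * J q) 2 (volume.restrict Ω)) := by
    intro h hh
    have hm := hh.continuousOn.aestronglyMeasurable (μ := volume) hΩ.measurableSet
    have hm2 : ContinuousOn (fun q => h (Φ q) * J q) Ω :=
      (hh.continuousOn.comp hΦ.continuous.continuousOn fun q hq => (hmem q).2 hq).mul
        hJ.continuous.continuousOn
    rw [memLp_two_iff_integrable_sq_norm hm,
      memLp_two_iff_integrable_sq_norm (hm2.aestronglyMeasurable hΩ.measurableSet)]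
    have hm3 : AEStronglyMeasurable (fun q => ‖h q‖ ^ 2) (volume.restrict Ω) := hm.norm.pow 2
    rw [← hmap'] at hm3
    conv_lhs => rw [← hmap']
    rw [integrable_map_measure hm3 hΦ.continuous.measurable.aemeasurable,
      integrable_withDensity_iff_integrable_smul hJm]
    refine iff_of_eq (congrArg (fun G : E → ℝ => Integrable G (volume.restrict Ω)) ?_)
    funext q
    simp only [Function.comp, norm_mul, mul_pow, NNReal.smul_def]
    push_cast
    simp [mul_comm]
  have hmemΨ : ∀ q ∈ Ω, Ψ q ∈ Ω := fun q hq => by rw [← hmem, hΦΨ]; exact hq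
  -- This is the transformation law `K(p, q) = J(p) K(Φ p, Φ q) conj(J(q))`, solved for the kernel
  -- at `Φ p`.
  set k' : E → ℂ := fun q => k (Ψ q) / (starRingEnd ℂ (J (Ψ q)) * J p) with hk'
  have hJc : ∀ q, starRingEnd ℂ (J q) ≠ 0 := fun q => by simpa using hJ0 q
  have hk'd : DifferentiableOn ℂ (fun q => starRingEnd ℂ (k' q)) Ω := by
    have e : (fun q => starRingEnd ℂ (k' q)) = fun q =>
        (fun w => starRingEnd ℂ (k w)) (Ψ q) * ((J (Ψ q))⁻¹ * (starRingEnd ℂ (J p))⁻¹) := by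
      funext q
      simp only [hk', map_div₀, map_mul, Complex.conj_conj]
      rw [div_eq_mul_inv, mul_inv]
    rw [e]
    refine (hk.1.1.comp hΨ.differentiableOn hmemΨ).mul (DifferentiableOn.mul_const ?_ _)
    exact ((hJ.comp hΨ).differentiableOn).inv fun q _ => hJ0 _
  refine ⟨k', ⟨⟨hk'd, ?_⟩, ?_⟩, ?_⟩
  · rw [hmemLp hk'd]
    have e : (fun q => starRingEnd ℂ (k' (Φ q)) * J q) = fun q =>
        (starRingEnd ℂ (J p))⁻¹ * starRingEnd ℂ (k q) := by
      funext q
      have := hJ0 q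
      have := hJc p
      simp only [hk', hΨΦ, map_div₀, map_mul, Complex.conj_conj]
      field_simp
    rw [e]
    exact hk.1.2.const_mul _
  · intro f hf
    have hcomp : DifferentiableOn ℂ (fun q => f (Φ q) * J q) Ω :=
      (hf.1.comp hΦ.differentiableOn fun q hq => (hmem q).2 hq).mul hJ.differentiableOn
    have h1 := hk.2 (fun q => f (Φ q) * J q) ⟨hcomp, (hmemLp hf.1).1 hf.2⟩
    have hk'c : ContinuousOn k' Ω := by
      have := Complex.continuous_conj.comp_continuousOn hk'd.continuousOn
      simpa [Function.comp_def] using this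
    rw [hint (G := fun q => f q * k' q) (hf.1.continuousOn.mul hk'c)]
    have e : ∀ q, (‖J q‖ ^ 2) • (f (Φ q) * k' (Φ q)) = (J p)⁻¹ * (f (Φ q) * J q * k q) := by
      intro q
      have h2 : ((‖J q‖ ^ 2 : ℝ) : ℂ) = J q * starRingEnd ℂ (J q) := by
        rw [Complex.mul_conj, Complex.normSq_eq_norm_sq]
      have := hJ0 q
      have := hJ0 p
      have := hJc q
      rw [Complex.real_smul, h2]
      simp only [hk', hΨΦ]
      field_simp
    simp_rw [e]
    rw [integral_const_mul, ← h1]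
    have := hJ0 p
    field_simp
  · intro h q hq
    exact div_ne_zero (h _ (hmemΨ q hq)) (mul_ne_zero (hJc _) (hJ0 p))

/-- Split `c` into a unimodular factor, which rotates each coordinate and preserves volume, and a
real dilation in real dimension `2m`. -/
theorem map_smul_complex_volume {m : ℕ} {c : ℂ} (hc : c ≠ 0) :
    Measure.map (fun x : Fin m → ℂ => c • x) volume
      = ENNReal.ofReal ((‖c‖ ^ (2 * m))⁻¹) • volume := by
  have hn : ‖c‖ ≠ 0 := norm_ne_zero_iff.2 hc
  have hu : ‖c / ‖c‖‖ = 1 := by simp [hn]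
  have h1 : Measure.map (fun (x : Fin m → ℂ) i => c / ‖c‖ * x i) volume = volume :=
    (volume_preserving_pi fun _ => measurePreserving_mul_of_norm_eq_one hu).map_eq
  have h2 := Measure.map_addHaar_smul (volume : Measure (Fin m → ℂ)) hn
  have e : (fun x : Fin m → ℂ => c • x) =
      (fun x => ‖c‖ • x) ∘ fun (x : Fin m → ℂ) i => c / ‖c‖ * x i := by
    funext x i
    have : (‖c‖ : ℂ) ≠ 0 := by exact_mod_cast hn
    simp only [Function.comp, Pi.smul_apply, smul_eq_mul, Complex.real_smul]
    field_simp
  rw [e, ← Measure.map_map (measurable_const_smul _) (by fun_prop), h1, h2]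
  simp only [Module.finrank_pi_fintype, Complex.finrank_real_complex, Finset.sum_const,
    Finset.card_univ, Fintype.card_fin, smul_eq_mul]
  rw [abs_of_nonneg (by positivity), mul_comm m 2]

/-- Change of variables for `(z, ζ) ↦ (z + a, c(z) ζ)`. -/
theorem map_withDensity_shear {n m : ℕ} (a : Fin n → ℂ) {c : (Fin n → ℂ) → ℂ} (hc : Continuous c)
    (hc0 : ∀ z, c z ≠ 0) :
    (volume.withDensity fun q : (Fin n → ℂ) × (Fin m → ℂ) => ‖c q.1 ^ m‖ₑ ^ 2).map
      (fun q => (q.1 + a, c q.1 • q.2)) = volume := by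
  have hΦ : Measurable fun q : (Fin n → ℂ) × (Fin m → ℂ) => (q.1 + a, c q.1 • q.2) :=
    (by fun_prop : Continuous _).measurable
  refine Measure.ext_of_lintegral _ fun G hG => ?_
  have hGΦ : Measurable fun q : (Fin n → ℂ) × (Fin m → ℂ) => G (q.1 + a, c q.1 • q.2) := hG.comp hΦ
  have hJ : Measurable fun q : (Fin n → ℂ) × (Fin m → ℂ) => ‖c q.1 ^ m‖ₑ ^ 2 :=
    (((hc.comp continuous_fst).pow m).measurable.enorm).pow_const 2
  rw [lintegral_map hG hΦ, lintegral_withDensity_eq_lintegral_mul _ hJ hGΦ,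
    Measure.volume_eq_prod, lintegral_prod _ hG.aemeasurable, lintegral_prod _
      (hJ.mul hGΦ).aemeasurable]
  -- For fixed `z` the fibre map is multiplication by `c z`, whose volume factor cancels the
  -- density. Translation invariance in the base does the rest.
  refine Eq.trans (lintegral_congr fun z => ?_)
    (lintegral_add_right_eq_self (fun z => ∫⁻ w : Fin m → ℂ, G (z, w)) a)
  have hGz : Measurable fun w => G (z + a, w) := hG.comp measurable_prodMk_left
  have h := lintegral_map (μ := volume) hGz (measurable_const_smul (c z) (α := Fin m → ℂ))
  rw [map_smul_complex_volume (hc0 z), lintegral_smul_measure] at h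
  simp only [Pi.mul_apply]
  have hGc : Measurable fun w : Fin m → ℂ => G (z + a, c z • w) :=
    hGz.comp (measurable_const_smul (c z))
  rw [lintegral_const_mul _ hGc, ← h, smul_eq_mul, ← mul_assoc]
  have hn : 0 < ‖c z‖ := norm_pos_iff.2 (hc0 z)
  have : ‖c z ^ m‖ₑ ^ 2 * ENNReal.ofReal ((‖c z‖ ^ (2 * m))⁻¹) = 1 := by
    rw [← ofReal_norm, ← ENNReal.ofReal_pow (norm_nonneg _),
      ← ENNReal.ofReal_mul (by positivity), norm_pow, ← pow_mul, mul_comm m 2,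
      mul_inv_cancel₀ (by positivity), ENNReal.ofReal_one]
  rw [this, one_mul]

/-- A unitary map of `ℂᵐ` taking `‖ζ‖ eᵢ` to `ζ`. -/
theorem exists_unitary_apply_single {m : ℕ} (i : Fin m) (ζ : Fin m → ℂ) :
    ∃ A : (Fin m → ℂ) ≃L[ℂ] (Fin m → ℂ), (∀ x, ∑ j, ‖A x j‖ ^ 2 = ∑ j, ‖x j‖ ^ 2) ∧
      ∃ s : ℂ, ‖s‖ ^ 2 = ∑ j, ‖ζ j‖ ^ 2 ∧ A (Pi.single i s) = ζ := by
  set x : EuclideanSpace ℂ (Fin m) := WithLp.toLp 2 ζ with hx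
  -- Normalise `ζ` and extend it to an orthonormal basis with `ζ / ‖ζ‖` in position `i`; for `ζ = 0`
  -- any basis serves.
  have key : ∃ b : OrthonormalBasis (Fin m) ℂ (EuclideanSpace ℂ (Fin m)), (‖x‖ : ℂ) • b i = x := by
    by_cases h0 : x = 0
    · exact ⟨EuclideanSpace.basisFun _ _, by simp [h0]⟩
    have hn : (‖x‖ : ℂ) ≠ 0 := by simpa using h0
    have hv : Orthonormal ℂ (({i} : Set (Fin m)).domRestrict
        fun _ => (‖x‖ : ℂ)⁻¹ • x) := by
      constructor
      · intro j
        simp only [Set.domRestrict_apply, norm_smul, norm_inv, Complex.norm_real, norm_norm]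
        exact inv_mul_cancel₀ (by simpa using h0)
      · intro j k hjk
        exact absurd (Subsingleton.elim j k) hjk
    obtain ⟨b, hb⟩ := hv.exists_orthonormalBasis_extension_of_card_eq (by simp)
    exact ⟨b, by rw [hb i rfl, smul_inv_smul₀ hn]⟩
  obtain ⟨b, hb⟩ := key
  have hnorm : ∀ y : EuclideanSpace ℂ (Fin m), ∑ j, ‖y.ofLp j‖ ^ 2 = ‖y‖ ^ 2 := fun y =>
    (EuclideanSpace.norm_sq_eq y).symm
  set e := PiLp.continuousLinearEquiv 2 ℂ (fun _ : Fin m => ℂ)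
  refine ⟨(e.symm.trans b.repr.symm.toContinuousLinearEquiv).trans e, fun y => ?_, ‖x‖, ?_, ?_⟩
  · have h1 := hnorm (b.repr.symm (WithLp.toLp 2 y))
    rw [LinearIsometryEquiv.norm_map, ← hnorm] at h1
    exact h1
  · rw [Complex.norm_real, norm_norm, ← hnorm]
  · have h2 : b.repr.symm (EuclideanSpace.single i (‖x‖ : ℂ)) = x := by
      rw [← hb]
      have : EuclideanSpace.single i (‖x‖ : ℂ) = (‖x‖ : ℂ) • EuclideanSpace.single i (1 : ℂ) := by
        ext j; simp
      rw [hb, this, map_smul, OrthonormalBasis.repr_symm_single, hb]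
    exact congrArg WithLp.ofLp h2

/-- A linear bijection multiplies volume by a constant. This one maps the Euclidean unit ball onto
itself, and that ball has finite positive volume, so the constant is `1`. -/
theorem map_unitary_volume {m : ℕ} (A : (Fin m → ℂ) ≃L[ℂ] (Fin m → ℂ))
    (hA : ∀ x, ∑ j, ‖A x j‖ ^ 2 = ∑ j, ‖x j‖ ^ 2) :
    Measure.map A (volume : Measure (Fin m → ℂ)) = volume := by
  set f : (Fin m → ℂ) →ₗ[ℝ] (Fin m → ℂ) :=
    (A.toLinearEquiv.restrictScalars ℝ : (Fin m → ℂ) →ₗ[ℝ] (Fin m → ℂ)) with hf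
  have hdet : LinearMap.det f ≠ 0 := (LinearEquiv.isUnit_det' _).ne_zero
  have h := Measure.map_linearMap_addHaar_eq_smul_addHaar (volume : Measure (Fin m → ℂ)) hdet
  set c := ENNReal.ofReal |(LinearMap.det f)⁻¹|
  have hfA : (f : (Fin m → ℂ) → (Fin m → ℂ)) = A := rfl
  rw [hfA] at h
  set S : Set (Fin m → ℂ) := {x | ∑ j, ‖x j‖ ^ 2 < 1} with hS
  have hSo : IsOpen S := isOpen_lt (by fun_prop) (by fun_prop)
  have hS0 : volume S ≠ 0 := (hSo.measure_pos _ ⟨0, by simp [hS]⟩).ne'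
  have hST : volume S ≠ ⊤ := by
    refine ((measure_mono (fun x hx => ?_)).trans_lt
      (measure_closedBall_lt_top (x := (0 : Fin m → ℂ)) (r := 1))).ne
    rw [mem_closedBall_zero_iff, pi_norm_le_iff_of_nonneg zero_le_one]
    intro j
    have h1 : ‖x j‖ ^ 2 ≤ ∑ j, ‖x j‖ ^ 2 := Finset.single_le_sum (f := fun j => ‖x j‖ ^ 2)
      (fun j _ => by positivity) (Finset.mem_univ j)
    have h2 : ‖x j‖ ^ 2 < 1 := h1.trans_lt hx
    exact ((sq_lt_one_iff₀ (norm_nonneg _)).1 h2).le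
  have h1 : Measure.map A (volume : Measure (Fin m → ℂ)) S = volume S := by
    rw [Measure.map_apply A.continuous.measurable hSo.measurableSet]
    congr 1
    ext x
    simp only [hS, Set.mem_preimage, Set.mem_ofPred_eq, hA]
  rw [h, Measure.smul_apply, smul_eq_mul] at h1
  have hc : c = 1 := by
    have := (ENNReal.mul_left_inj hS0 hST).1 (h1.trans (one_mul _).symm)
    exact this
  rw [h, hc, one_smul]

/-- The fibre factor `exp (-μ ⟨z, a⟩ - μ ‖a‖² / 2)` of the automorphism of `hartogsFock μ n m` that
translates the base by `a`. -/
noncomputable def fockFactor (μ : ℝ) {n : ℕ} (a z : Fin n → ℂ) : ℂ :=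
  Complex.exp (-μ * ∑ i, z i * starRingEnd ℂ (a i) - μ / 2 * ∑ i, a i * starRingEnd ℂ (a i))

theorem differentiable_fockFactor (μ : ℝ) {n : ℕ} (a : Fin n → ℂ) :
    Differentiable ℂ (fockFactor μ a) := by
  unfold fockFactor
  fun_prop

theorem fockFactor_ne_zero (μ : ℝ) {n : ℕ} (a z : Fin n → ℂ) : fockFactor μ a z ≠ 0 :=
  Complex.exp_ne_zero _

theorem fockFactor_mul_fockFactor_neg (μ : ℝ) {n : ℕ} (a z : Fin n → ℂ) :
    fockFactor μ (-a) (z + a) * fockFactor μ a z = 1 := by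
  unfold fockFactor
  rw [← Complex.exp_add, ← Complex.exp_zero]
  congr 1
  simp only [Pi.add_apply, Pi.neg_apply, map_neg, mul_neg, neg_mul, neg_neg, add_mul,
    Finset.sum_add_distrib, Finset.sum_neg_distrib]
  ring

/-- Expanding `‖z + a‖²` shows that the factor scales the fibre over `z` exactly to the fibre over
`z + a`. -/
theorem norm_fockFactor_sq_mul (μ : ℝ) {n : ℕ} (a z : Fin n → ℂ) :
    ‖fockFactor μ a z‖ ^ 2 * Real.exp (-μ * ∑ i, ‖z i‖ ^ 2)
      = Real.exp (-μ * ∑ i, ‖z i + a i‖ ^ 2) := by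
  unfold fockFactor
  rw [Complex.norm_exp, ← Real.exp_nat_mul, ← Real.exp_add]
  congr 1
  have h1 : ∀ i, ‖z i + a i‖ ^ 2 = ‖z i‖ ^ 2 + ‖a i‖ ^ 2 + 2 * (z i * starRingEnd ℂ (a i)).re := by
    intro i
    rw [← Complex.normSq_eq_norm_sq, ← Complex.normSq_eq_norm_sq, ← Complex.normSq_eq_norm_sq,
      Complex.normSq_add]
  have h2 : ∀ i, (a i * starRingEnd ℂ (a i)) = ((‖a i‖ ^ 2 : ℝ) : ℂ) := by
    intro i
    rw [Complex.mul_conj, Complex.normSq_eq_norm_sq]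
  simp_rw [h1, h2, Finset.sum_add_distrib, ← Finset.mul_sum]
  rw [← Complex.ofReal_sum, ← Complex.re_sum]
  have h3 : (-(μ : ℂ) * ∑ i, z i * starRingEnd ℂ (a i) -
      μ / 2 * ((∑ i, ‖a i‖ ^ 2 : ℝ) : ℂ)).re
      = -μ * (∑ i, z i * starRingEnd ℂ (a i)).re - μ / 2 * ∑ i, ‖a i‖ ^ 2 := by
    rw [show (-(μ : ℂ)) = ((-μ : ℝ) : ℂ) by push_cast; rfl,
      show ((μ : ℂ) / 2) = ((μ / 2 : ℝ) : ℂ) by push_cast; rfl, ← Complex.ofReal_mul,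
      Complex.sub_re, Complex.re_ofReal_mul, Complex.ofReal_re]
  rw [h3]
  push_cast
  ring

theorem shear_mem_hartogsFock_iff (μ : ℝ) {n m : ℕ} (a : Fin n → ℂ)
    (q : (Fin n → ℂ) × (Fin m → ℂ)) :
    (q.1 + a, fockFactor μ a q.1 • q.2) ∈ hartogsFock μ n m ↔ q ∈ hartogsFock μ n m := by
  have h : 0 < ‖fockFactor μ a q.1‖ ^ 2 := by
    have := norm_pos_iff.2 (fockFactor_ne_zero μ a q.1)
    positivity
  simp only [hartogsFock, Set.mem_ofPred_eq, Pi.add_apply, Pi.smul_apply, norm_smul, mul_pow,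
    ← Finset.mul_sum, ← norm_fockFactor_sq_mul]
  exact mul_lt_mul_iff_right₀ h

theorem IsReproducingAt.shear {μ : ℝ} {n m : ℕ} (a : Fin n → ℂ)
    {p : (Fin n → ℂ) × (Fin m → ℂ)} {k : (Fin n → ℂ) × (Fin m → ℂ) → ℂ}
    (hk : IsReproducingAt (hartogsFock μ n m) p k) :
    ∃ k', IsReproducingAt (hartogsFock μ n m) (p.1 + a, fockFactor μ a p.1 • p.2) k' ∧
      ((∀ q ∈ hartogsFock μ n m, k q ≠ 0) → ∀ q ∈ hartogsFock μ n m, k' q ≠ 0) := by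
  have hd := fun a : Fin n → ℂ => differentiable_fockFactor μ a
  refine hk.transport (isOpen_hartogsFock μ n m)
    (Φ := fun q => (q.1 + a, fockFactor μ a q.1 • q.2))
    (Ψ := fun q => (q.1 + -a, fockFactor μ (-a) q.1 • q.2))
    (J := fun q => fockFactor μ a q.1 ^ m) ?_ ?_ ?_ ?_ ?_ ?_ ?_ ?_
  · exact (differentiable_fst.add_const a).prodMk
      (((hd a).comp differentiable_fst).smul differentiable_snd)
  · exact (differentiable_fst.add_const (-a)).prodMk
      (((hd (-a)).comp differentiable_fst).smul differentiable_snd)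
  · exact ((hd a).comp differentiable_fst).pow m
  · intro q
    have := fockFactor_mul_fockFactor_neg μ (-a) q.1
    rw [neg_neg] at this
    simp [smul_smul, this]
  · intro q
    simp [smul_smul, fockFactor_mul_fockFactor_neg]
  · exact fun q => pow_ne_zero _ (fockFactor_ne_zero μ a q.1)
  · exact shear_mem_hartogsFock_iff μ a
  · exact map_withDensity_shear a (hd a).continuous (fockFactor_ne_zero μ a)

theorem IsReproducingAt.unitary {μ : ℝ} {n m : ℕ} (A : (Fin m → ℂ) ≃L[ℂ] (Fin m → ℂ))
    (hA : ∀ x, ∑ j, ‖A x j‖ ^ 2 = ∑ j, ‖x j‖ ^ 2)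
    {p : (Fin n → ℂ) × (Fin m → ℂ)} {k : (Fin n → ℂ) × (Fin m → ℂ) → ℂ}
    (hk : IsReproducingAt (hartogsFock μ n m) p k) :
    ∃ k', IsReproducingAt (hartogsFock μ n m) (p.1, A p.2) k' ∧
      ((∀ q ∈ hartogsFock μ n m, k q ≠ 0) → ∀ q ∈ hartogsFock μ n m, k' q ≠ 0) := by
  refine hk.transport (isOpen_hartogsFock μ n m) (Φ := fun q => (q.1, A q.2))
    (Ψ := fun q => (q.1, A.symm q.2)) (J := fun _ => 1)
    ?_ ?_ (differentiable_const _) ?_ ?_ ?_ ?_ ?_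
  · exact differentiable_fst.prodMk (A.differentiable.comp differentiable_snd)
  · exact differentiable_fst.prodMk (A.symm.differentiable.comp differentiable_snd)
  · simp
  · simp
  · simp
  · intro q
    simp only [hartogsFock, Set.mem_ofPred_eq, hA]
  · have h1 : MeasurePreserving A (volume : Measure (Fin m → ℂ)) volume :=
      ⟨A.continuous.measurable, map_unitary_volume A hA⟩
    have h2 := ((MeasurePreserving.id (volume : Measure (Fin n → ℂ))).prod h1).map_eq
    simp only [enorm_one, one_pow, withDensity_const, one_smul]
    exact h2

/-! ### Arbitrary points and conclusion -/

/-- Every point of `hartogsFock μ n m` is the image of some `(0, s eᵢ)` under an automorphism. -/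
theorem exists_isReproducingAt {μ : ℝ} (hμ : 0 < μ) {n m : ℕ} (i : Fin m)
    {p : (Fin n → ℂ) × (Fin m → ℂ)} (hp : p ∈ hartogsFock μ n m) :
    ∃ k, IsReproducingAt (hartogsFock μ n m) p k ∧
      ((∀ t : ℂ, ‖t‖ < 1 → ∑' k, (fockCoeff n m k : ℂ) * t ^ k ≠ 0) →
        ∀ q ∈ hartogsFock μ n m, k q ≠ 0) := by
  -- Chosen so that the shear by `p.1` sends `(0, ζ)` to `p`; a unitary map then reduces `ζ` to `s
  -- eᵢ`.
  set ζ := (fockFactor μ p.1 0)⁻¹ • p.2 with hζ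
  have hsh : ((0 : Fin n → ℂ) + p.1, fockFactor μ p.1 0 • ζ) = p := by
    rw [hζ, smul_inv_smul₀ (fockFactor_ne_zero μ p.1 0), zero_add]
  have hmem : ((0 : Fin n → ℂ), ζ) ∈ hartogsFock μ n m := by
    rw [← shear_mem_hartogsFock_iff μ p.1]
    simpa only [hsh] using hp
  obtain ⟨A, hA, s, hs, hAs⟩ := exists_unitary_apply_single i ζ
  have hs1 : ‖s‖ < 1 := by
    have : ‖s‖ ^ 2 < 1 := by
      rw [hs]
      simpa [hartogsFock] using hmem
    exact (sq_lt_one_iff₀ (norm_nonneg _)).1 this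
  have h0 := isReproducingAt_single hμ n i hs1
  obtain ⟨k₁, hk₁, hn₁⟩ := h0.unitary A hA
  obtain ⟨k₂, hk₂, hn₂⟩ := hk₁.shear p.1
  simp only [hAs, hsh] at hk₂
  refine ⟨k₂, hk₂, fun h => hn₂ (hn₁ fun q hq => mul_ne_zero ?_ (h _ ?_))⟩
  · rw [Complex.ofReal_ne_zero]
    positivity
  · rw [norm_mul, RCLike.norm_conj]
    exact mul_lt_one_of_nonneg_of_lt_one_left (norm_nonneg _) hs1
      (norm_lt_one_of_mem_hartogsFock hμ.le hq i).le

theorem isBergmanKernel_bergmanKernel {E : Type*} [NormedAddCommGroup E] [NormedSpace ℂ E]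
    [MeasureSpace E] {Ω : Set E} (h : ∀ p ∈ Ω, ∃ k, IsReproducingAt Ω p k) :
    IsBergmanKernel Ω (bergmanKernel Ω) := by
  classical
  have hex : ∃ K : E → E → ℂ, IsBergmanKernel Ω K :=
    ⟨fun p => if hp : p ∈ Ω then (h p hp).choose else 0, fun p hp => by
      simp only [dif_pos hp]
      exact (h p hp).choose_spec⟩
  rw [bergmanKernel, dif_pos hex]
  exact hex.choose_spec

/-- Replacing the row of the kernel at `p` by `k` gives another reproducing kernel, so uniqueness
identifies the two. -/
theorem IsReproducingAt.eq_bergmanKernel {E : Type*} [NormedAddCommGroup E] [NormedSpace ℂ E]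
    [MeasureSpace E] [BorelSpace E] [(volume : Measure E).IsOpenPosMeasure]
    {Ω : Set E} (hΩ : IsOpen Ω) (hK : IsBergmanKernel Ω (bergmanKernel Ω)) {p q : E} {k : E → ℂ}
    (hk : IsReproducingAt Ω p k) (hp : p ∈ Ω) (hq : q ∈ Ω) : bergmanKernel Ω p q = k q := by
  classical
  have hK' : IsBergmanKernel Ω (Function.update (bergmanKernel Ω) p k) := by
    intro z hz
    by_cases h : z = p
    · subst h
      rw [Function.update_self]
      exact hk
    · rw [Function.update_of_ne h]
      exact hK z hz
  rw [hK.unique hΩ hK' hp hq, Function.update_self]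

theorem theorem3 (μ : ℝ) (hμ : 0 < μ) (n m : ℕ) :
    (n = 1 → 1 ≤ m →
      IsBergmanKernel (hartogsFock μ n m) (bergmanKernel (hartogsFock μ n m)) ∧
      ∀ p ∈ hartogsFock μ n m, ∀ q ∈ hartogsFock μ n m,
        bergmanKernel (hartogsFock μ n m) p q ≠ 0) ∧
    (m = 1 → 2 ≤ n →
      IsBergmanKernel (hartogsFock μ n m) (bergmanKernel (hartogsFock μ n m)) ∧
      ∃ p ∈ hartogsFock μ n m, ∃ q ∈ hartogsFock μ n m,
        bergmanKernel (hartogsFock μ n m) p q = 0) := by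
  have hΩ := isOpen_hartogsFock μ n m
  -- Existence at every point rules out the junk value `0` of `bergmanKernel`.
  have hK : 1 ≤ m → IsBergmanKernel (hartogsFock μ n m) (bergmanKernel (hartogsFock μ n m)) :=
    fun hm => isBergmanKernel_bergmanKernel fun p hp =>
      (exists_isReproducingAt hμ ⟨0, hm⟩ hp).imp fun _ h => h.1
  constructor
  · rintro rfl hm
    refine ⟨hK hm, fun p hp q hq => ?_⟩
    obtain ⟨k, hk, hne⟩ := exists_isReproducingAt hμ ⟨0, hm⟩ hp
    rw [hk.eq_bergmanKernel hΩ (hK hm) hp hq]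
    exact hne (fun t ht => tsum_fockCoeff_one_ne_zero hm ht) q hq
  · rintro rfl hn
    refine ⟨hK le_rfl, ?_⟩
    obtain ⟨x, hx1, hx0, hx⟩ := exists_tsum_fockCoeff_eq_zero hn
    -- With `y = √(-x) < 1`, the points `(0, y)` and `(0, -y)` lie in the domain and the series is
    -- evaluated at `y * (-y) = x`.
    have hy0 : 0 < √(-x) := Real.sqrt_pos.2 (by linarith)
    have hy2 : √(-x) ^ 2 = -x := Real.sq_sqrt (by linarith)
    have hy : ‖(√(-x) : ℂ)‖ < 1 := by
      rw [Complex.norm_real, Real.norm_of_nonneg hy0.le]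
      nlinarith
    have hp := single_mem_hartogsFock μ n (0 : Fin 1) hy
    have hq := single_mem_hartogsFock μ n (0 : Fin 1) (w := -(√(-x) : ℂ)) (by rwa [norm_neg])
    refine ⟨_, hp, _, hq, ?_⟩
    rw [(isReproducingAt_single hμ n 0 hy).eq_bergmanKernel hΩ (hK le_rfl) hp hq]
    have e : (√(-x) : ℂ) * starRingEnd ℂ ((Pi.single (0 : Fin 1) (-(√(-x) : ℂ)) : Fin 1 → ℂ) 0)
        = (x : ℂ) := by
      rw [Pi.single_eq_same, map_neg, Complex.conj_ofReal]
      have : ((√(-x) ^ 2 : ℝ) : ℂ) = ((-x : ℝ) : ℂ) := congrArg _ hy2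
      push_cast at this
      linear_combination -this
    simp only [e, hx, mul_zero]
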